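/- **Setting.** A trigonometric polynomial is a function $\mu(\mathbf r)=\sum_{\mathbf k\in\mathbb Z^2} c[\mathbf k]\,e^{j2\pi\langle \mathbf k,\mathbf r\rangle}$, $\mathbf r=(x,y)$, with finitely many non-zero coefficients $c[\mathbf k]\in\mathbb C$. Its degree $\deg(\mu)$ is the pair of dimensions (numbers of columns and of rows of lattice points) of the smallest rectangle in $\mathbb Z^2$ that contains its frequency support, and $\nu\mid\mu$ means that $\mu=\nu\gamma$ for a trigonometric polynomial $\gamma$. Write $\{\mu=0\}$ for the zero set of $\mu$ in $[0,1]^2$. A trigonometric polynomial $\mu_0$ is a minimal polynomial of $C\subset[0,1]^2$ if $C=\{\mu_0=0\}$ and every trigonometric polynomial $\mu$ with $C=\{\mu=0\}$ satisfies $\deg(\mu_0)\le\deg(\mu)$ (componentwise) and $\mu_0\mid\mu$. For a function $f$ supported in $[0,1]^2$, $\widehat{f_x}$ and $\widehat{f_y}$ denote the Fourier transforms of the distributional derivatives $f_x=\partial_x f$ and $f_y=\partial_y f$. **Theorem 2.** Let $f=\sum_{i=1}^n a_i\chi_{\Omega_i}$ with $a_i\in\mathbb C\setminus\{0\}$, where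 the $\Omega_i\subset[0,1]^2$ are simply connected (open) regions whose boundaries $\partial\Omega_i$ are pairwise disjoint and $\partial\Omega_i=\{\mu_i=0\}$ with $\mu_i$ a minimal polynomial of $\partial\Omega_i$. Let $\mu=\mu_1\cdots\mu_n$, and suppose that $\Lambda=\{(k,l)\in\mathbb Z^2:|k|\le K,\ |l|\le L\}$ is the smallest rectangle that contains the frequency support of $\mu$; put $2\Lambda=\{(k,l)\in\mathbb Z^2:|k|\le 2K,\ |l|\le 2L\}$. Then the coefficients of $\mu$ are a non-trivial solution $d[\mathbf k]$, $\mathbf k\in\Lambda$, of $$\begin{cases}\sum_{\mathbf k\in\Lambda} d[\mathbf k]\,\widehat{f_x}(2\pi[\mathbf l-\mathbf k])=0,\\ \sum_{\mathbf k\in\Lambda} d[\mathbf k]\,\widehat{f_y}(2\pi[\mathbf l-\mathbf k])=0,\end{cases}\qquad\text{for all }\mathbf l\in2\Lambda,$$ and every non-trivial solution $d[\mathbf k]$, $\mathbf k\in\Lambda$, consists of the coefficients of $c\,\mu$ for some $c\in\mathbb C\setminus\{0\}$. In particular, for every non-trivial solution $d$ the zero set in $[0,1]^2$ of the trigonometric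 polynomial with coefficients $d$ is the edge set $C=\bigcup_{i=1}^n\partial\Omega_i$. -/

import Mathlib

open scoped BigOperators

noncomputable section

namespace TrigCurve

/-- Bivariate trigonometric polynomials `∑ₖ c[k] e^{j2π⟨k,r⟩}`, given by their finitely supported
coefficients `c : ℤ × ℤ → ℂ`; the multiplication of this algebra is the convolution of
coefficients, that is, the pointwise multiplication of functions. -/
abbrev TrigPoly : Type := AddMonoidAlgebra ℂ (ℤ × ℤ)

/-- The value `∑ₖ c[k] e^{j2π⟨k,r⟩}` of a trigonometric polynomial at `r = (x, y)`. -/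
def TrigPoly.eval (p : TrigPoly) (r : ℝ × ℝ) : ℂ :=
  ∑ k ∈ p.coeff.support, p.coeff k *
    Complex.exp (Complex.I * ((2 * Real.pi * ((k.1 : ℝ) * r.1 + (k.2 : ℝ) * r.2) : ℝ) : ℂ))

/-- The closed unit square `[0,1]²`. -/
def unitSquare : Set (ℝ × ℝ) := Set.Icc 0 1 ×ˢ Set.Icc 0 1

/-- The zero set `{p = 0}` in `[0,1]²`. -/
def zeroSet (p : TrigPoly) : Set (ℝ × ℝ) := {r ∈ unitSquare | p.eval r = 0}

/-- The degree of a trigonometric polynomial: the dimensions (numbers of columns and of rows of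
lattice points) of the smallest rectangle that contains the frequency support. -/
def TrigPoly.deg (p : TrigPoly) : ℕ × ℕ :=
  ({m : ℤ | ∃ k ∈ p.coeff.support, ∃ l ∈ p.coeff.support, k.1 ≤ m ∧ m ≤ l.1}.ncard,
   {m : ℤ | ∃ k ∈ p.coeff.support, ∃ l ∈ p.coeff.support, k.2 ≤ m ∧ m ≤ l.2}.ncard)

/-- `μ₀` is a minimal polynomial of the trigonometric curve `C`: its zero set is `C`, and it has
the smallest degree among, and divides, all trigonometric polynomials whose zero set is `C`. -/
structure IsMinimalPoly (μ₀ : TrigPoly) (C : Set (ℝ × ℝ)) : Prop where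
  zeroSet_eq : zeroSet μ₀ = C
  deg_le : ∀ μ : TrigPoly, zeroSet μ = C → μ₀.deg ≤ μ.deg
  dvd : ∀ μ : TrigPoly, zeroSet μ = C → μ₀ ∣ μ

/-- The rectangle of frequencies `{(k, l) : |k| ≤ K, |l| ≤ L}`. Its dilation by a factor `m` is
`freqRect (m * K) (m * L)`. -/
def freqRect (K L : ℕ) : Finset (ℤ × ℤ) :=
  Finset.Icc (-(K : ℤ)) K ×ˢ Finset.Icc (-(L : ℤ)) L

/-- The piecewise constant function `∑ᵢ aᵢ χ_{Ωᵢ}`. -/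
def piecewiseConst {n : ℕ} (a : Fin n → ℂ) (Ω : Fin n → Set (ℝ × ℝ)) (r : ℝ × ℝ) : ℂ :=
  ∑ i, (Ω i).indicator (fun _ => a i) r

/-- The pairing `⟨∂ᵥ f, φ⟩ = -∫ f ∂ᵥ φ` of the distributional derivative of `f` in the direction
`v` with a smooth function `φ` (for integrable `f` of compact support). -/
def distDeriv (f : ℝ × ℝ → ℂ) (v : ℝ × ℝ) (φ : ℝ × ℝ → ℂ) : ℂ :=
  -∫ r, f r * fderiv ℝ φ r v

/-- The Fourier transform of the compactly supported distribution `∂ᵥ f` at `ω`: its pairing with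
`r ↦ e^{-j⟨ω,r⟩}`. -/
def fourierDeriv (f : ℝ × ℝ → ℂ) (v : ℝ × ℝ) (ω : ℝ × ℝ) : ℂ :=
  distDeriv f v fun r => Complex.exp (-Complex.I * ((ω.1 * r.1 + ω.2 * r.2 : ℝ) : ℂ))

/-- The frequency `2π k` for `k ∈ ℤ²`. -/
def latticeFreq (k : ℤ × ℤ) : ℝ × ℝ := (2 * Real.pi * k.1, 2 * Real.pi * k.2)

/-- The coefficients `d[k]`, `k ∈ Λ`, solve the annihilation equations
`∑_{k ∈ Λ} d[k] (f_x)^(2π(l - k)) = 0` and `∑_{k ∈ Λ} d[k] (f_y)^(2π(l - k)) = 0`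
for all `l ∈ Γ`. -/
def SolvesAnnihilation (f : ℝ × ℝ → ℂ) (Λ Γ : Finset (ℤ × ℤ)) (d : ℤ × ℤ → ℂ) : Prop :=
  ∀ l ∈ Γ,
    ∑ k ∈ Λ, d k * fourierDeriv f (1, 0) (latticeFreq (l - k)) = 0 ∧
    ∑ k ∈ Λ, d k * fourierDeriv f (0, 1) (latticeFreq (l - k)) = 0

end TrigCurve

end

/-! The sums in the annihilation equations at `l` equal `-∑ᵢ aᵢ ∫_{Ωᵢ} ∂ᵥ(d e_{-l})`, where `e_k` is
the character of frequency `k`. By the divergence theorem these are boundary fluxes, and a multiple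
of `μᵢ` has none through `∂Ωᵢ` (`RealForm.regionFlux_mul_eq_zero`); hence the product `μ` is a
solution.

Conversely, let `d` be a solution. By linearity `∑ⱼ aⱼ ∫_{Ωⱼ} ∂ᵥ(d φ) = 0` for every `φ` with
frequencies in `2Λ`. Fix `i`, put `g = ∏_{j ≠ i} μⱼ` and take `φ = conj(d) g ∂ᵥμᵢ`. The factor `g
∂ᵥμᵢ` has frequencies in `Λ` because `μ = g μᵢ` does, so `φ` is admissible. All terms `j ≠ i` drop
out, since `μⱼ` divides `φ`. Adding the directions `x` and `y` leaves, up to phases, the flux of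
`|d|² g ∇μᵢ` through `∂Ωᵢ`, whose density is `|d|² g |∇μᵢ|`. After removal of the phases `g` is
real, and it has no zero on `∂Ωᵢ`. Simple connectivity makes `∂Ωᵢ` connected
(`isPreconnected_frontier`), so `g` has constant sign there and `d ∇μᵢ = 0` on `∂Ωᵢ`
(`fderiv_eq_zero_of_flux_eq_zero`).

Minimality turns this into `d = 0` on `∂Ωᵢ` (`eval_eq_zero_of_mul_derivative`): `μᵢ` divides every
`d^m D^m μᵢ`, so at a point of the curve with `d ≠ 0` all iterated derivatives of `μᵢ` would vanish.
Then every `μᵢ` divides `d`, so does the product since the curves are disjoint, and comparing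
rectangles shows that the quotient is constant.

The curves may be singular, so boundary integrals are replaced by limits of integrals over thin
layers where `μᵢ` is small. -/

noncomputable section

/-! ### Algebra of trigonometric polynomials: evaluation, derivations, conjugation, extremal
frequencies. -/

namespace TrigCurve

open Complex Finset

/-- The character `r ↦ e^{j2π⟨k,r⟩}`. -/
def character (k : ℤ × ℤ) (r : ℝ × ℝ) : ℂ :=
  Complex.exp (Complex.I * ((2 * Real.pi * ((k.1 : ℝ) * r.1 + (k.2 : ℝ) * r.2) : ℝ) : ℂ))

lemma character_zero (r : ℝ × ℝ) : character 0 r = 1 := by simp [character]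

lemma character_add (k l : ℤ × ℤ) (r : ℝ × ℝ) :
    character (k + l) r = character k r * character l r := by
  rw [character, character, character, ← Complex.exp_add]
  congr 1
  push_cast [Prod.fst_add, Prod.snd_add]
  ring

lemma character_ne_zero (k : ℤ × ℤ) (r : ℝ × ℝ) : character k r ≠ 0 := Complex.exp_ne_zero _

lemma conj_character (k : ℤ × ℤ) (r : ℝ × ℝ) :
    starRingEnd ℂ (character k r) = character (-k) r := by
  rw [character, character, ← Complex.exp_conj]
  congr 1
  simp only [map_mul, Complex.conj_I, Complex.conj_ofReal, Prod.fst_neg, Prod.snd_neg]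
  push_cast
  ring

/-- Evaluation at `r` as an algebra homomorphism. -/
def evalHom (r : ℝ × ℝ) : TrigPoly →ₐ[ℂ] ℂ :=
  AddMonoidAlgebra.lift ℂ ℂ (ℤ × ℤ)
    { toFun := fun k => character k.toAdd r
      map_one' := character_zero r
      map_mul' := fun k l => character_add k.toAdd l.toAdd r }

lemma eval_eq_sum (p : TrigPoly) (r : ℝ × ℝ) :
    p.eval r = ∑ k ∈ p.coeff.support, p.coeff k * character k r := rfl

lemma eval_eq_evalHom (p : TrigPoly) (r : ℝ × ℝ) : p.eval r = evalHom r p := by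
  rw [eval_eq_sum, evalHom, AddMonoidAlgebra.lift_apply, Finsupp.sum]
  simp [smul_eq_mul]

lemma eval_eq_sum_of_subset (p : TrigPoly) {s : Finset (ℤ × ℤ)} (h : p.coeff.support ⊆ s)
    (r : ℝ × ℝ) : p.eval r = ∑ k ∈ s, p.coeff k * character k r := by
  rw [eval_eq_sum]
  refine Finset.sum_subset h fun k _ hk => ?_
  rw [Finsupp.notMem_support_iff.mp hk, zero_mul]

@[simp] lemma eval_mul (p q : TrigPoly) (r : ℝ × ℝ) : (p * q).eval r = p.eval r * q.eval r := by
  simp [eval_eq_evalHom]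

@[simp] lemma eval_add (p q : TrigPoly) (r : ℝ × ℝ) : (p + q).eval r = p.eval r + q.eval r := by
  simp [eval_eq_evalHom]

@[simp] lemma eval_sub (p q : TrigPoly) (r : ℝ × ℝ) : (p - q).eval r = p.eval r - q.eval r := by
  simp [eval_eq_evalHom]

@[simp] lemma eval_smul (c : ℂ) (p : TrigPoly) (r : ℝ × ℝ) : (c • p).eval r = c * p.eval r := by
  simp [eval_eq_evalHom]

@[simp] lemma eval_one (r : ℝ × ℝ) : (1 : TrigPoly).eval r = 1 := by
  simp [eval_eq_evalHom]

@[simp] lemma eval_zero (r : ℝ × ℝ) : (0 : TrigPoly).eval r = 0 := by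
  simp [eval_eq_evalHom]

lemma eval_prod {ι : Type*} (s : Finset ι) (p : ι → TrigPoly) (r : ℝ × ℝ) :
    (∏ i ∈ s, p i).eval r = ∏ i ∈ s, (p i).eval r := by
  simp [eval_eq_evalHom]

lemma eval_single (k : ℤ × ℤ) (c : ℂ) (r : ℝ × ℝ) :
    TrigPoly.eval (AddMonoidAlgebra.single k c) r = c * character k r := by
  simp [eval_eq_evalHom, evalHom]

/-- The Fourier multiplier with symbol `w`. -/
def multiplier (w : ℤ × ℤ → ℂ) (p : TrigPoly) : TrigPoly :=
  .ofCoeff (Finsupp.onFinset p.coeff.support (fun k => w k * p.coeff k) fun _ hk =>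
    Finsupp.mem_support_iff.mpr (right_ne_zero_of_mul hk))

lemma multiplier_coeff (w : ℤ × ℤ → ℂ) (p : TrigPoly) (k : ℤ × ℤ) :
    (multiplier w p).coeff k = w k * p.coeff k := rfl

lemma support_multiplier_subset (w : ℤ × ℤ → ℂ) (p : TrigPoly) :
    (multiplier w p).coeff.support ⊆ p.coeff.support := fun _ hk =>
  Finsupp.mem_support_iff.mpr (right_ne_zero_of_mul (Finsupp.mem_support_iff.mp hk))

lemma eval_multiplier (w : ℤ × ℤ → ℂ) (p : TrigPoly) (r : ℝ × ℝ) :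
    (multiplier w p).eval r = ∑ k ∈ p.coeff.support, w k * p.coeff k * character k r :=
  eval_eq_sum_of_subset _ (support_multiplier_subset w p) r

lemma multiplier_iterate_coeff (w : ℤ × ℤ → ℂ) (p : TrigPoly) (m : ℕ) (k : ℤ × ℤ) :
    ((multiplier w)^[m] p).coeff k = w k ^ m * p.coeff k := by
  induction m generalizing p with
  | zero => simp
  | succ m ih => rw [Function.iterate_succ_apply, ih, multiplier_coeff, pow_succ, mul_assoc]

/-- A multiplier with additive symbol is a derivation. -/
lemma multiplier_mul (w : ℤ × ℤ →+ ℂ) (p q : TrigPoly) :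
    multiplier w (p * q) = multiplier w p * q + p * multiplier w q := by
  have add (p q : TrigPoly) : multiplier w (p + q) = multiplier w p + multiplier w q := by
    ext k
    simp [multiplier_coeff, mul_add]
  have single (k : ℤ × ℤ) (c : ℂ) : multiplier w (AddMonoidAlgebra.single k c) =
      AddMonoidAlgebra.single k (w k * c) := by
    ext l
    by_cases h : k = l
    · subst h; simp [multiplier_coeff]
    · simp [multiplier_coeff, h]
  have zero : multiplier w 0 = 0 := by
    ext k
    simp [multiplier_coeff]
  induction p using AddMonoidAlgebra.induction_linear with
  | zero => simp [zero]
  | add p₁ p₂ h₁ h₂ => rw [add_mul, add, h₁, h₂, add]; ring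
  | single k c =>
    induction q using AddMonoidAlgebra.induction_linear with
    | zero => simp [zero]
    | add p₁ p₂ h₁ h₂ => rw [mul_add, add, h₁, h₂, add]; ring
    | single l d =>
      simp only [AddMonoidAlgebra.single_mul_single, single, map_add]
      rw [← AddMonoidAlgebra.single_add]
      congr 1
      ring

/-- The symbol `k₁ + j k₂`, an injective additive function on `ℤ²`. -/
def complexSymbol : ℤ × ℤ →+ ℂ where
  toFun k := k.1 + Complex.I * k.2
  map_zero' := by simp
  map_add' k l := by push_cast [Prod.fst_add, Prod.snd_add]; ring

lemma complexSymbol_injective : Function.Injective complexSymbol := by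
  intro k l h
  have h' : (k.1 : ℂ) + Complex.I * k.2 = l.1 + Complex.I * l.2 := h
  have h1 := congrArg Complex.re h'
  have h2 := congrArg Complex.im h'
  simp at h1 h2
  exact Prod.ext (by exact_mod_cast h1) (by exact_mod_cast h2)

/-- A trigonometric polynomial all of whose iterated derivatives vanish at a point is zero. -/
lemma eq_zero_of_iterate_multiplier_eval (p : TrigPoly) (r : ℝ × ℝ)
    (h : ∀ m : ℕ, ((multiplier complexSymbol)^[m] p).eval r = 0) : p = 0 := by
  -- The `m`-th iterate gives the case `P = X ^ m`, and linearity gives all `P`. As the symbols of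
  -- distinct frequencies differ, a product of linear factors then isolates a single coefficient.
  have key : ∀ P : Polynomial ℂ,
      ∑ k ∈ p.coeff.support, P.eval (complexSymbol k) * (p.coeff k * character k r) = 0 := by
    intro P
    induction P using Polynomial.induction_on' with
    | add P Q hP hQ => simp [add_mul, Finset.sum_add_distrib, hP, hQ]
    | monomial n a =>
      have hs : ((multiplier complexSymbol)^[n] p).coeff.support ⊆ p.coeff.support := by
        intro k hk
        rw [Finsupp.mem_support_iff, multiplier_iterate_coeff] at hk
        exact Finsupp.mem_support_iff.mpr (right_ne_zero_of_mul hk)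
      have := h n
      rw [eval_eq_sum_of_subset _ hs] at this
      simp only [multiplier_iterate_coeff] at this
      simp only [Polynomial.eval_monomial]
      calc _ = a * ∑ k ∈ p.coeff.support,
            complexSymbol k ^ n * p.coeff k * character k r := by
              rw [Finset.mul_sum]; exact Finset.sum_congr rfl fun _ _ => by ring
        _ = 0 := by rw [this, mul_zero]
  by_contra hp
  obtain ⟨k, hk⟩ : p.coeff.support.Nonempty := by
    rw [Finsupp.support_nonempty_iff]
    simpa using hp
  have := key (∏ l ∈ p.coeff.support.erase k,
    (Polynomial.X - Polynomial.C (complexSymbol l)))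
  rw [Finset.sum_eq_single k] at this
  · rcases mul_eq_zero.mp this with h0 | h0
    · rw [Polynomial.eval_prod, Finset.prod_eq_zero_iff] at h0
      obtain ⟨l, hl, hl0⟩ := h0
      simp only [Polynomial.eval_sub, Polynomial.eval_X, Polynomial.eval_C, sub_eq_zero] at hl0
      exact (Finset.ne_of_mem_erase hl) (complexSymbol_injective hl0).symm
    · exact (mul_ne_zero (Finsupp.mem_support_iff.mp hk) (character_ne_zero k r)) h0
  · intro l hl hlk
    rw [Polynomial.eval_prod, Finset.prod_eq_zero (Finset.mem_erase.mpr ⟨hlk, hl⟩) (by simp),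
      zero_mul]
  · intro h; exact absurd hk h

/-- The symbol of the Fourier multiplier `∂ᵥ`. -/
def derivSymbol (v : ℝ × ℝ) : ℤ × ℤ →+ ℂ where
  toFun k := 2 * Real.pi * Complex.I * (k.1 * v.1 + k.2 * v.2)
  map_zero' := by simp
  map_add' k l := by push_cast [Prod.fst_add, Prod.snd_add]; ring

lemma contDiff_character (k : ℤ × ℤ) : ContDiff ℝ ⊤ (character k) := by
  unfold character
  refine ContDiff.cexp (contDiff_const.mul ?_)
  exact Complex.ofRealCLM.contDiff.comp (contDiff_const.mul
    ((contDiff_const.mul contDiff_fst).add (contDiff_const.mul contDiff_snd)))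

lemma contDiff_eval (p : TrigPoly) : ContDiff ℝ ⊤ p.eval := by
  show ContDiff ℝ ⊤ fun r => ∑ k ∈ p.coeff.support, p.coeff k * character k r
  exact ContDiff.sum fun k _ => contDiff_const.mul (contDiff_character k)

lemma fderiv_character (k : ℤ × ℤ) (r v : ℝ × ℝ) :
    fderiv ℝ (character k) r v = derivSymbol v k * character k r := by
  have h1 : HasFDerivAt (fun r : ℝ × ℝ => 2 * Real.pi * ((k.1 : ℝ) * r.1 + (k.2 : ℝ) * r.2))
      ((2 * Real.pi) • ((k.1 : ℝ) • ContinuousLinearMap.fst ℝ ℝ ℝ +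
        (k.2 : ℝ) • ContinuousLinearMap.snd ℝ ℝ ℝ)) r :=
    ((hasFDerivAt_fst.const_mul _).add (hasFDerivAt_snd.const_mul _)).const_mul _
  have h2 := ((Complex.ofRealCLM.hasFDerivAt.comp r h1).const_mul Complex.I).cexp
  have h3 : HasFDerivAt (character k) _ r := h2
  rw [h3.fderiv]
  simp [character, derivSymbol]
  ring

/-- Directional derivatives act as Fourier multipliers. -/
lemma fderiv_eval (p : TrigPoly) (r v : ℝ × ℝ) :
    fderiv ℝ p.eval r v = (multiplier (derivSymbol v) p).eval r := by
  rw [eval_multiplier]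
  have : p.eval = fun r => ∑ k ∈ p.coeff.support, p.coeff k * character k r := rfl
  have hd (k : ℤ × ℤ) : DifferentiableAt ℝ (character k) r :=
    (contDiff_character k).differentiable (by simp) r
  rw [this, fderiv_fun_sum fun k _ => (hd k).const_mul _]
  simp only [FunLike.coe_sum, Finset.sum_apply]
  refine Finset.sum_congr rfl fun k _ => ?_
  rw [fderiv_const_mul (hd k), smul_apply, fderiv_character, smul_eq_mul]
  ring

/-- The complex symbol is a combination of the partial derivatives. -/
lemma eval_multiplier_complexSymbol (p : TrigPoly) (r : ℝ × ℝ) :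
    2 * Real.pi * Complex.I * (multiplier complexSymbol p).eval r =
      (multiplier (derivSymbol (1, 0)) p).eval r +
        Complex.I * (multiplier (derivSymbol (0, 1)) p).eval r := by
  simp only [eval_multiplier, Finset.mul_sum, ← Finset.sum_add_distrib]
  refine Finset.sum_congr rfl fun k _ => ?_
  simp [derivSymbol, complexSymbol]
  ring

/-- Trigonometric polynomials are determined by their values. -/
lemma eval_injective : Function.Injective TrigPoly.eval := by
  intro p q h
  rw [← sub_eq_zero]
  have hpq : (p - q).eval = fun _ => 0 := by
    ext r; simp [h]
  have hD : ∀ s : TrigPoly, (s.eval = fun _ => 0) →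
      (multiplier complexSymbol s).eval = fun _ => 0 := by
    intro s hs
    ext r
    have h1 := eval_multiplier_complexSymbol s r
    rw [← fderiv_eval, ← fderiv_eval, hs] at h1
    simpa [Real.pi_ne_zero] using h1
  refine eq_zero_of_iterate_multiplier_eval _ 0 fun m => ?_
  suffices H : ((multiplier complexSymbol)^[m] (p - q)).eval = fun _ => 0 from congrFun H 0
  induction m with
  | zero => exact hpq
  | succ m ih => rw [Function.iterate_succ_apply']; exact hD _ ih

/-- The coefficients of the complex conjugate of a trigonometric polynomial. -/
def conjPoly (p : TrigPoly) : TrigPoly :=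
  .ofCoeff ((p.coeff.mapRange (starRingEnd ℂ) (map_zero _)).equivMapDomain (Equiv.neg _))

lemma conjPoly_coeff (p : TrigPoly) (k : ℤ × ℤ) :
    (conjPoly p).coeff k = starRingEnd ℂ (p.coeff (-k)) := by
  simp [conjPoly]

lemma mem_support_conjPoly (p : TrigPoly) (k : ℤ × ℤ) :
    k ∈ (conjPoly p).coeff.support ↔ -k ∈ p.coeff.support := by
  simp [conjPoly_coeff]

@[simp] lemma eval_conjPoly (p : TrigPoly) (r : ℝ × ℝ) :
    (conjPoly p).eval r = starRingEnd ℂ (p.eval r) := by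
  rw [eval_eq_sum, eval_eq_sum, map_sum]
  refine Finset.sum_bij' (fun k _ => -k) (fun k _ => -k) ?_ ?_ ?_ ?_ ?_
  · intro k hk; exact (mem_support_conjPoly p k).mp hk
  · intro k hk; rw [mem_support_conjPoly, neg_neg]; exact hk
  · simp
  · simp
  · intro k _
    rw [conjPoly_coeff, map_mul, conj_character, neg_neg]

lemma conjPoly_conjPoly (p : TrigPoly) : conjPoly (conjPoly p) = p :=
  eval_injective (by ext r; simp)

lemma conjPoly_mul (p q : TrigPoly) : conjPoly (p * q) = conjPoly p * conjPoly q :=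
  eval_injective (by ext r; simp)

/-- The supremum of an additive functional over the frequency support is attained on a product
at the sum of points where it is attained on the factors. -/
lemma exists_extremal_frequencies (w : ℤ × ℤ →+ ℤ) {p q : TrigPoly} (hp : p ≠ 0) (hq : q ≠ 0) :
    ∃ k ∈ p.coeff.support, ∃ l ∈ q.coeff.support, k + l ∈ (p * q).coeff.support ∧
      (∀ k' ∈ p.coeff.support, w k' ≤ w k) ∧ ∀ l' ∈ q.coeff.support, w l' ≤ w l := by
  classical
  have ne {p : TrigPoly} (hp : p ≠ 0) : p.coeff.support.Nonempty := by
    rw [Finsupp.support_nonempty_iff]; simpa using hp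
  have top {p : TrigPoly} (hp : p ≠ 0) :
      (p.coeff.support.filter fun k => ∀ k' ∈ p.coeff.support, w k' ≤ w k).Nonempty := by
    obtain ⟨k, hk, hmax⟩ := p.coeff.support.exists_max_image w (ne hp)
    exact ⟨k, Finset.mem_filter.mpr ⟨hk, hmax⟩⟩
  -- Several frequencies may attain the maximum of `w`. Among the maximisers a pair with a unique
  -- sum is chosen, so that its coefficient in the product cannot cancel.
  obtain ⟨k, hk, l, hl, huniq⟩ := UniqueSums.uniqueAdd_of_nonempty (top hp) (top hq)
  rw [Finset.mem_filter] at hk hl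
  have hu : UniqueAdd p.coeff.support q.coeff.support k l := by
    intro k' l' hk' hl' heq
    have h1 := hk.2 k' hk'
    have h2 := hl.2 l' hl'
    have h3 := congrArg w heq
    rw [map_add, map_add] at h3
    refine huniq (Finset.mem_filter.mpr ⟨hk', fun a ha => ?_⟩)
      (Finset.mem_filter.mpr ⟨hl', fun a ha => ?_⟩) heq
    · have := hk.2 a ha; omega
    · have := hl.2 a ha; omega
  refine ⟨k, hk.1, l, hl.1, ?_, hk.2, hl.2⟩
  rw [Finsupp.mem_support_iff, AddMonoidAlgebra.coeff_mul_add_of_uniqueAdd hu]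
  exact mul_ne_zero (Finsupp.mem_support_iff.mp hk.1) (Finsupp.mem_support_iff.mp hl.1)

/-- A trigonometric polynomial of modulus one is a monomial. -/
lemma eq_single_of_mul_conjPoly_eq_one {γ : TrigPoly} (h : γ * conjPoly γ = 1) :
    ∃ (m : ℤ × ℤ) (c : ℂ), ‖c‖ = 1 ∧ γ = AddMonoidAlgebra.single m c := by
  classical
  have hγ : γ ≠ 0 := by rintro rfl; simp at h
  have hγ' : conjPoly γ ≠ 0 := by intro h0; simp [h0] at h
  have hsupp : ∀ k ∈ (γ * conjPoly γ).coeff.support, k = 0 := by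
    intro k hk
    rw [h] at hk
    by_contra hk0
    rw [Finsupp.mem_support_iff, AddMonoidAlgebra.one_def, AddMonoidAlgebra.coeff_single,
      Finsupp.single_apply, if_neg (Ne.symm hk0)] at hk
    exact hk rfl
  have const (w : ℤ × ℤ →+ ℤ) : ∀ k ∈ γ.coeff.support, ∀ l ∈ γ.coeff.support, w k ≤ w l := by
    obtain ⟨a, ha, b, hb, hab, hamax, hbmax⟩ := exists_extremal_frequencies w hγ hγ'
    have h0 := congrArg w (hsupp _ hab)
    rw [map_add, map_zero] at h0
    intro k hk l hl
    have h1 := hamax k hk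
    -- The maximum of `w` over the support of the conjugate is minus its minimum over that of `γ`,
    -- so `max w - min w = 0`.
    have h2 := hbmax (-l) (by rw [mem_support_conjPoly, neg_neg]; exact hl)
    rw [map_neg] at h2
    omega
  obtain ⟨m, hm⟩ : γ.coeff.support.Nonempty := by
    rw [Finsupp.support_nonempty_iff]; simpa using hγ
  have hall : ∀ k ∈ γ.coeff.support, k = m := fun k hk =>
    Prod.ext (le_antisymm (const (AddMonoidHom.fst ℤ ℤ) k hk m hm)
      (const (AddMonoidHom.fst ℤ ℤ) m hm k hk))
      (le_antisymm (const (AddMonoidHom.snd ℤ ℤ) k hk m hm)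
      (const (AddMonoidHom.snd ℤ ℤ) m hm k hk))
  have hs : γ = AddMonoidAlgebra.single m (γ.coeff m) := by
    ext k
    by_cases hk : k = m
    · subst hk; simp
    · rw [AddMonoidAlgebra.coeff_single, Finsupp.single_apply, if_neg (Ne.symm hk)]
      by_contra hne
      exact hk (hall k (Finsupp.mem_support_iff.mpr hne))
  refine ⟨m, γ.coeff m, ?_, hs⟩
  have he := congrArg (fun p : TrigPoly => p.eval 0) h
  simp only [eval_mul, eval_conjPoly, eval_one] at he
  rw [hs, eval_single, Complex.mul_conj] at he
  have hc : character m 0 = 1 := by simp [character]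
  rw [hc, mul_one, Complex.normSq_eq_norm_sq] at he
  have : ‖γ.coeff m‖ ^ 2 = 1 := by exact_mod_cast he
  exact (pow_eq_one_iff_of_nonneg (norm_nonneg _) two_ne_zero).mp this

end TrigCurve

/-! ### Minimal polynomials: divisibility and the gradient on the curve. -/

namespace TrigCurve

open Complex Finset

lemma conjPoly_add (p q : TrigPoly) : conjPoly (p + q) = conjPoly p + conjPoly q :=
  eval_injective (by ext r; simp)

lemma conjPoly_sub (p q : TrigPoly) : conjPoly (p - q) = conjPoly p - conjPoly q :=
  eval_injective (by ext r; simp)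

lemma conjPoly_smul (c : ℂ) (p : TrigPoly) :
    conjPoly (c • p) = starRingEnd ℂ c • conjPoly p :=
  eval_injective (by ext r; simp)

lemma zeroSet_conjPoly (p : TrigPoly) : zeroSet (conjPoly p) = zeroSet p := by
  ext r
  simp [zeroSet]

namespace IsMinimalPoly

variable {μ : TrigPoly} {C : Set (ℝ × ℝ)}

lemma eval_eq_zero (h : IsMinimalPoly μ C) {r : ℝ × ℝ} (hr : r ∈ C) : μ.eval r = 0 := by
  rw [← h.zeroSet_eq] at hr
  exact hr.2

/-- A minimal polynomial is real up to a factor of modulus one. -/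
lemma exists_phase (h : IsMinimalPoly μ C) (hμ : μ ≠ 0) :
    ∃ γ : TrigPoly, conjPoly μ = γ * μ ∧ γ * conjPoly γ = 1 := by
  obtain ⟨γ, hγ⟩ := h.dvd (conjPoly μ) (by rw [zeroSet_conjPoly, h.zeroSet_eq])
  refine ⟨γ, by rw [hγ, mul_comm], ?_⟩
  have h1 : conjPoly (conjPoly μ) = conjPoly μ * conjPoly γ := by
    conv_lhs => rw [hγ]
    rw [conjPoly_mul]
  rw [conjPoly_conjPoly, hγ] at h1
  refine mul_left_cancel₀ hμ ?_
  rw [← mul_assoc, ← h1, mul_one]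

/-- A minimal polynomial divides every trigonometric polynomial vanishing on its curve. -/
lemma dvd_of_eval_eq_zero (h : IsMinimalPoly μ C) (hμ : μ ≠ 0) {q : TrigPoly}
    (hq : ∀ r ∈ C, q.eval r = 0) : μ ∣ q := by
  obtain ⟨γ, hγ, hu⟩ := h.exists_phase hμ
  have hu' (r : ℝ × ℝ) : γ.eval r * starRingEnd ℂ (γ.eval r) = 1 := by
    rw [← eval_conjPoly, ← eval_mul, hu, eval_one]
  have inPhase {s : TrigPoly} (hs : conjPoly s = γ * s) (hs0 : ∀ r ∈ C, s.eval r = 0) :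
      μ ∣ s := by
    -- Minimality speaks only of polynomials whose zero set is exactly `C`. Since `μ` and `s` share
    -- a phase, they act as real and imaginary part of `μ + i s`, which vanishes only where both do.
    have hd : μ ∣ μ + Complex.I • s := by
      refine h.dvd _ (Set.Subset.antisymm ?_ ?_)
      · rintro r ⟨hr, h0⟩
        rw [← h.zeroSet_eq]
        refine ⟨hr, ?_⟩
        have h1 : starRingEnd ℂ (μ.eval r) = γ.eval r * μ.eval r := by
          rw [← eval_conjPoly, hγ, eval_mul]
        have h2 : starRingEnd ℂ (s.eval r) = γ.eval r * s.eval r := by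
          rw [← eval_conjPoly, hs, eval_mul]
        rw [eval_add, eval_smul] at h0
        have h3 := congrArg (starRingEnd ℂ) h0
        rw [map_add, map_mul, h1, h2, Complex.conj_I, map_zero] at h3
        have hγr : γ.eval r ≠ 0 := left_ne_zero_of_mul_eq_one (hu' r)
        have h4 : γ.eval r * (μ.eval r - Complex.I * s.eval r) = 0 := by
          rw [← h3]; ring
        have h5 := (mul_eq_zero.mp h4).resolve_left hγr
        linear_combination (h0 + h5) / 2
      · intro r hr
        have hr' := hr
        rw [← h.zeroSet_eq] at hr'
        exact ⟨hr'.1, by rw [eval_add, eval_smul, hr'.2, hs0 r hr, mul_zero, add_zero]⟩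
    have h6 : μ ∣ Complex.I • s := (dvd_add_right dvd_rfl).mp hd
    obtain ⟨t, ht⟩ := h6
    refine ⟨(-Complex.I) • t, ?_⟩
    rw [mul_smul_comm, ← ht, smul_smul]
    simp
  have hcu : conjPoly γ * γ = 1 := by rw [mul_comm, hu]
  -- With `γ⁻¹ = conjPoly γ`, the elements `q + γ⁻¹ q̄` and `i (q - γ⁻¹ q̄)` are twice the real part
  -- and minus twice the imaginary part of `q` relative to the phase of `μ`.
  have h1 : μ ∣ q + conjPoly γ * conjPoly q := by
    refine inPhase ?_ fun r hr => by simp [hq r hr]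
    rw [conjPoly_add, conjPoly_mul, conjPoly_conjPoly, conjPoly_conjPoly, mul_add, ← mul_assoc,
      hu, one_mul, add_comm]
  have h2 : μ ∣ Complex.I • (q - conjPoly γ * conjPoly q) := by
    refine inPhase ?_ fun r hr => by simp [hq r hr]
    rw [conjPoly_smul, conjPoly_sub, conjPoly_mul, conjPoly_conjPoly, conjPoly_conjPoly,
      mul_smul_comm, mul_sub, ← mul_assoc, hu, one_mul, Complex.conj_I, neg_smul, ← smul_neg,
      neg_sub]
  obtain ⟨s, hs⟩ := h1
  obtain ⟨t, ht⟩ := h2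
  refine ⟨(1 / 2 : ℂ) • (s - Complex.I • t), ?_⟩
  rw [mul_smul_comm, mul_sub, mul_smul_comm, ← hs, ← ht, smul_smul, Complex.I_mul_I, neg_smul,
    one_smul, sub_neg_eq_add, add_add_sub_cancel, ← two_smul ℂ q, smul_smul]
  norm_num

/-- The gradient of a minimal polynomial vanishes on no relatively open part of the curve. -/
lemma eval_eq_zero_of_mul_derivative (h : IsMinimalPoly μ C) (hμ : μ ≠ 0) {d : TrigPoly}
    (hd : ∀ r ∈ C, d.eval r * (multiplier complexSymbol μ).eval r = 0) :
    ∀ r ∈ C, d.eval r = 0 := by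
  set D := multiplier complexSymbol with hD
  have hDd : μ ∣ d * D μ := h.dvd_of_eval_eq_zero hμ fun r hr => by
    rw [eval_mul, hd r hr]
  have pow (m : ℕ) : d ^ m ∣ d * D (d ^ m) := by
    induction m with
    | zero => simp
    | succ m ih =>
      rw [pow_succ, hD, multiplier_mul, ← hD, mul_add]
      refine dvd_add ?_ ?_
      · rw [← mul_assoc]; exact mul_dvd_mul ih dvd_rfl
      · exact ⟨D d, by ring⟩
  -- Apply `D` to `d ^ m * D^[m] μ = μ * s` and multiply by `d`. Modulo `μ`, the term `d * D μ * s`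
  -- vanishes by `hDd`, and `d * D (d ^ m) * D^[m] μ` by `pow` and the induction hypothesis.
  have key (m : ℕ) : μ ∣ d ^ m * D^[m] μ := by
    induction m with
    | zero => simp
    | succ m ih =>
      obtain ⟨s, hs⟩ := ih
      have h1 := congrArg D hs
      rw [hD, multiplier_mul, multiplier_mul, ← hD] at h1
      obtain ⟨t, ht⟩ := pow m
      obtain ⟨u, hu⟩ := hDd
      rw [Function.iterate_succ_apply']
      refine ⟨u * s + d * D s - s * t, ?_⟩
      linear_combination d * h1 + s * hu - D^[m] μ * ht - t * hs
  intro r hr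
  by_contra hne
  refine hμ (eq_zero_of_iterate_multiplier_eval μ r fun m => ?_)
  obtain ⟨s, hs⟩ := key m
  have h1 := congrArg (fun p : TrigPoly => p.eval r) hs
  simp only [eval_mul] at h1
  rw [h.eval_eq_zero hr, zero_mul] at h1
  have hpow : (d ^ m).eval r ≠ 0 := by
    rw [eval_eq_evalHom, map_pow, ← eval_eq_evalHom]
    exact pow_ne_zero m hne
  exact (mul_eq_zero.mp h1).resolve_left hpow

end IsMinimalPoly

/-- Minimal polynomials of disjoint curves are coprime. -/
lemma prod_dvd_of_forall_eval_eq_zero {ι : Type*} (s : Finset ι) {μ : ι → TrigPoly}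
    {C : ι → Set (ℝ × ℝ)} (hμ : ∀ i ∈ s, IsMinimalPoly (μ i) (C i)) (hμ0 : ∀ i ∈ s, μ i ≠ 0)
    (hdisj : Pairwise fun i j => Disjoint (C i) (C j)) {d : TrigPoly}
    (hd : ∀ i ∈ s, ∀ r ∈ C i, d.eval r = 0) : (∏ i ∈ s, μ i) ∣ d := by
  classical
  induction s using Finset.induction_on with
  | empty => simp
  | insert i s hi ih =>
    obtain ⟨q, hq⟩ := ih (fun j hj => hμ j (mem_insert_of_mem hj))
      (fun j hj => hμ0 j (mem_insert_of_mem hj)) fun j hj => hd j (mem_insert_of_mem hj)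
    -- On `C i` the factors already split off have no zero, because the curves are disjoint; so the
    -- quotient `q` itself vanishes there.
    have hqi : μ i ∣ q := by
      refine (hμ i (mem_insert_self i s)).dvd_of_eval_eq_zero (hμ0 i (mem_insert_self i s))
        fun r hr => ?_
      have h1 := hd i (mem_insert_self i s) r hr
      rw [hq, eval_mul, eval_prod] at h1
      refine (mul_eq_zero.mp h1).resolve_left (Finset.prod_ne_zero_iff.mpr fun j hj h0 => ?_)
      have hij : i ≠ j := by rintro rfl; exact hi hj
      have hrs : r ∈ unitSquare := by
        rw [← (hμ i (mem_insert_self i s)).zeroSet_eq] at hr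
        exact hr.1
      have hrj : r ∈ C j := by
        rw [← (hμ j (mem_insert_of_mem hj)).zeroSet_eq]
        exact ⟨hrs, h0⟩
      exact Set.disjoint_left.mp (hdisj hij) hr hrj
    obtain ⟨t, ht⟩ := hqi
    refine ⟨t, ?_⟩
    rw [Finset.prod_insert hi, hq, ht]
    ring

/-! ### Frequency rectangles and comparison of degrees. -/

lemma mem_freqRect {K L : ℕ} {k : ℤ × ℤ} :
    k ∈ freqRect K L ↔ (-(K : ℤ) ≤ k.1 ∧ k.1 ≤ K) ∧ -(L : ℤ) ≤ k.2 ∧ k.2 ≤ L := by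
  simp [freqRect]

/-- An interval of frequencies has the full length only if its end points are attained. -/
lemma exists_le_of_ncard_eq (s : Finset (ℤ × ℤ)) (w : ℤ × ℤ → ℤ) (N : ℕ)
    (hs : ∀ k ∈ s, -(N : ℤ) ≤ w k ∧ w k ≤ N)
    (hcard : {m : ℤ | ∃ k ∈ s, ∃ l ∈ s, w k ≤ m ∧ m ≤ w l}.ncard = 2 * N + 1) :
    (∃ k ∈ s, (N : ℤ) ≤ w k) ∧ ∃ k ∈ s, w k ≤ -(N : ℤ) := by
  have hsub : {m : ℤ | ∃ k ∈ s, ∃ l ∈ s, w k ≤ m ∧ m ≤ w l} ⊆ Set.Icc (-(N : ℤ)) N := by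
    rintro m ⟨k, hk, l, hl, h1, h2⟩
    exact ⟨(hs k hk).1.trans h1, h2.trans (hs l hl).2⟩
  have heq := Set.eq_of_subset_of_ncard_le hsub (by
    rw [hcard, ← Finset.coe_Icc, Set.ncard_coe_finset, Int.card_Icc]
    omega) (Set.finite_Icc _ _)
  have h1 : (N : ℤ) ∈ Set.Icc (-(N : ℤ)) N := ⟨by omega, le_rfl⟩
  have h2 : (-(N : ℤ)) ∈ Set.Icc (-(N : ℤ)) N := ⟨le_rfl, by omega⟩
  rw [← heq] at h1 h2
  obtain ⟨_, _, l, hl, _, hl'⟩ := h1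
  obtain ⟨k, hk, _, _, hk', _⟩ := h2
  exact ⟨⟨l, hl, hl'⟩, k, hk, hk'⟩

/-- A quotient of trigonometric polynomials with support in the smallest rectangle containing the
support of the divisor is a constant. -/
lemma support_quotient_subset {K L : ℕ} {μ γ : TrigPoly} (hμ : μ ≠ 0) (hγ : γ ≠ 0)
    (hsupp : μ.coeff.support ⊆ freqRect K L) (hdeg : μ.deg = (2 * K + 1, 2 * L + 1))
    (hd : (μ * γ).coeff.support ⊆ freqRect K L) : ∀ l ∈ γ.coeff.support, l = 0 := by
  -- Maxima of `w` add under multiplication. The maximum for `μ` is already at least the bound `N`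
  -- for the product, which leaves at most `0` for `γ`; below this is used for both signs of each
  -- coordinate.
  have main (w : ℤ × ℤ →+ ℤ) (N : ℤ) (h1 : ∀ k ∈ (μ * γ).coeff.support, w k ≤ N)
      (h2 : ∃ k ∈ μ.coeff.support, N ≤ w k) : ∀ l ∈ γ.coeff.support, w l ≤ 0 := by
    obtain ⟨a, _, b, _, hab, hamax, hbmax⟩ := exists_extremal_frequencies w hμ hγ
    obtain ⟨k, hk, hNk⟩ := h2
    intro l hl
    have e1 := h1 _ hab
    have e2 := hamax k hk
    have e3 := hbmax l hl
    rw [map_add] at e1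
    omega
  obtain ⟨x1, x2⟩ := exists_le_of_ncard_eq μ.coeff.support Prod.fst K
    (fun k hk => (mem_freqRect.mp (hsupp hk)).1) (congrArg Prod.fst hdeg)
  obtain ⟨y1, y2⟩ := exists_le_of_ncard_eq μ.coeff.support Prod.snd L
    (fun k hk => (mem_freqRect.mp (hsupp hk)).2) (congrArg Prod.snd hdeg)
  intro l hl
  have a1 := main (AddMonoidHom.fst ℤ ℤ) K (fun k hk => (mem_freqRect.mp (hd hk)).1.2) x1 l hl
  have a2 := main (-AddMonoidHom.fst ℤ ℤ) K
    (fun k hk => by have := (mem_freqRect.mp (hd hk)).1.1; simp; omega)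
    (by obtain ⟨k, hk, h⟩ := x2; exact ⟨k, hk, by simp; omega⟩) l hl
  have b1 := main (AddMonoidHom.snd ℤ ℤ) L (fun k hk => (mem_freqRect.mp (hd hk)).2.2) y1 l hl
  have b2 := main (-AddMonoidHom.snd ℤ ℤ) L
    (fun k hk => by have := (mem_freqRect.mp (hd hk)).2.1; simp; omega)
    (by obtain ⟨k, hk, h⟩ := y2; exact ⟨k, hk, by simp; omega⟩) l hl
  simp at a1 a2 b1 b2
  exact Prod.ext (le_antisymm a1 a2) (le_antisymm b1 b2)

lemma eq_smul_one_of_support {γ : TrigPoly} (h : ∀ l ∈ γ.coeff.support, l = 0) :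
    γ = γ.coeff 0 • (1 : TrigPoly) := by
  classical
  ext k
  rw [AddMonoidAlgebra.coeff_smul_apply, AddMonoidAlgebra.one_def, AddMonoidAlgebra.coeff_single,
    Finsupp.single_apply]
  split_ifs with hk
  · subst hk; simp
  · simp only [smul_zero]
    by_contra hne
    exact hk (h k (Finsupp.mem_support_iff.mpr hne)).symm

/-- If a product has support in a rectangle, so does the product with one factor differentiated. -/
lemma support_mul_multiplier_subset {K L : ℕ} {g μ : TrigPoly} (hg : g ≠ 0) (hμ : μ ≠ 0)
    (h : (g * μ).coeff.support ⊆ freqRect K L) (w : ℤ × ℤ → ℂ) :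
    (g * multiplier w μ).coeff.support ⊆ freqRect K L := by
  classical
  -- The sum of the two extremal frequencies survives in `g * μ`, so the bound holds for all sums of
  -- frequencies, including those that cancel in `g * μ` but not after differentiation.
  have main (u : ℤ × ℤ →+ ℤ) (N : ℤ) (h1 : ∀ k ∈ (g * μ).coeff.support, u k ≤ N) :
      ∀ k ∈ g.coeff.support, ∀ l ∈ μ.coeff.support, u (k + l) ≤ N := by
    obtain ⟨a, _, b, _, hab, hamax, hbmax⟩ := exists_extremal_frequencies u hg hμ
    intro k hk l hl
    have e1 := h1 _ hab
    have e2 := hamax k hk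
    have e3 := hbmax l hl
    rw [map_add] at e1 ⊢
    omega
  intro x hx
  obtain ⟨k, hk, l, hl, rfl⟩ := Finset.mem_add.mp (AddMonoidAlgebra.support_coeff_mul_subset _ _ hx)
  replace hl := support_multiplier_subset w μ hl
  have a1 := main (AddMonoidHom.fst ℤ ℤ) K (fun k hk => (mem_freqRect.mp (h hk)).1.2) k hk l hl
  have a2 := main (-AddMonoidHom.fst ℤ ℤ) K
    (fun k hk => by have := (mem_freqRect.mp (h hk)).1.1; simp; omega) k hk l hl
  have b1 := main (AddMonoidHom.snd ℤ ℤ) L (fun k hk => (mem_freqRect.mp (h hk)).2.2) k hk l hl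
  have b2 := main (-AddMonoidHom.snd ℤ ℤ) L
    (fun k hk => by have := (mem_freqRect.mp (h hk)).2.1; simp; omega) k hk l hl
  simp at a1 a2 b1 b2
  rw [mem_freqRect]
  simp only [Prod.fst_add, Prod.snd_add]
  omega

lemma support_conjPoly_mul_subset {K L : ℕ} {p q : TrigPoly}
    (hp : p.coeff.support ⊆ freqRect K L) (hq : q.coeff.support ⊆ freqRect K L) :
    (conjPoly p * q).coeff.support ⊆ freqRect (2 * K) (2 * L) := by
  classical
  intro x hx
  obtain ⟨k, hk, l, hl, rfl⟩ := Finset.mem_add.mp (AddMonoidAlgebra.support_coeff_mul_subset _ _ hx)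
  have h1 := mem_freqRect.mp (hp ((mem_support_conjPoly p k).mp hk))
  have h2 := mem_freqRect.mp (hq hl)
  rw [mem_freqRect]
  simp only [Prod.fst_add, Prod.snd_add, Prod.fst_neg, Prod.snd_neg] at h1 ⊢
  push_cast
  omega

end TrigCurve

/-! ### Plane topology: the frontier of a bounded simply connected open set is connected. -/

namespace TrigCurve

open Complex

/-- A continuous function with constant exponential on a preconnected set is constant. -/
lemma eq_of_exp_eq_const {X : Type*} [TopologicalSpace X] {s : Set X} (hs : IsPreconnected s)
    {h : X → ℂ} (hc : ContinuousOn h s) {c : ℂ} (he : ∀ x ∈ s, Complex.exp (h x) = c)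
    {x y : X} (hx : x ∈ s) (hy : y ∈ s) : h x = h y :=
  IsSeparatedMap.constOn_of_comp (T2Space.isSeparatedMap
      fun z : ℂ => (⟨_, z.exp_ne_zero⟩ : {z : ℂ // z ≠ 0}))
    Complex.isCoveringMap_exp.isLocalHomeomorph.isLocallyInjective hs hc
    (fun a ha b hb => Subtype.ext ((he a ha).trans (he b hb).symm)) hx hy

/-- A continuous nowhere zero function on the plane has a continuous logarithm. -/
lemma exists_continuous_log {g : ℂ → ℂ} (hg : Continuous g) (h0 : ∀ z, g z ≠ 0) :
    ∃ θ : ℂ → ℂ, Continuous θ ∧ ∀ z, Complex.exp (θ z) = g z := by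
  obtain ⟨F, ⟨_, hF⟩, _⟩ := Complex.isCoveringMapOn_exp.existsUnique_continuousMap_lifts
    (⟨g, hg⟩ : C(ℂ, ℂ)) (a₀ := 0) (e₀ := Complex.log (g 0)) (Complex.exp_log (h0 0)) h0
  exact ⟨F, F.continuous, fun z => congrFun hF z⟩

/-- The function `z ↦ z - a` has no continuous logarithm on a circle around `a`. -/
lemma false_of_log_on_circle {θ : ℂ → ℂ} (hθ : Continuous θ) {a : ℂ} {ρ : ℝ}
    (h : ∀ t : ℝ, Complex.exp (θ (a + ρ * Complex.exp (t * Complex.I))) =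
      ρ * Complex.exp (t * Complex.I)) : False := by
  -- This function has constant exponential `ρ`, hence is constant; but over one turn `θ` returns to
  -- its value while `t * I` grows by `2πi`.
  have hc : Continuous fun t : ℝ => θ (a + ρ * Complex.exp (t * Complex.I)) - t * Complex.I := by
    fun_prop
  have hconst := eq_of_exp_eq_const isPreconnected_univ hc.continuousOn (c := ρ)
    (fun t _ => by rw [Complex.exp_sub, h t, mul_div_assoc, div_self (Complex.exp_ne_zero _),
      mul_one]) (Set.mem_univ 0) (Set.mem_univ (2 * Real.pi))
  have h1 : Complex.exp (((2 * Real.pi : ℝ) : ℂ) * Complex.I) = 1 := by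
    push_cast; exact Complex.exp_two_pi_mul_I
  simp only [h1] at hconst
  have h2 : (2 * Real.pi * Complex.I : ℂ) = 0 := by
    simp at hconst
    linear_combination hconst
  simp [Real.pi_ne_zero] at h2

/-- The complement of a bounded simply connected open set has no bounded component. -/
lemma false_of_bounded_part_of_compl {U A B : Set ℂ} (hU : IsOpen U) (hUs : IsSimplyConnected U)
    (hA : IsClosed A) (hB : IsClosed B) (hAB : Disjoint A B) (hcup : A ∪ B = Uᶜ) {a : ℂ}
    (ha : a ∈ A) {R : ℝ} (hR : ∀ z : ℂ, R ≤ ‖z‖ → z ∈ B) : False := by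
  classical
  have haU : a ∉ U := by
    have : a ∈ Uᶜ := hcup ▸ Or.inl ha
    exact this
  obtain ⟨l, hl, hexp⟩ := Complex.exists_continuousOn_eqOn_exp_comp hUs hU
    (g := fun z => z - a) (by fun_prop) (by
      rintro ⟨z, hz, h0⟩
      rw [sub_eq_zero] at h0
      exact haU (h0 ▸ hz))
  obtain ⟨u, hu0, hu1, _⟩ := exists_continuous_zero_one_of_isClosed hA hB hAB
  -- Rescaling makes `v` equal to `0` near `A` and to `1` near `B`, so that `G` below is locally `1`
  -- or `z - a` there, even though `l` need not extend to the boundary of `U`.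
  set v : ℂ → ℝ := fun z => max 0 (min 1 (3 * u z - 1)) with hv
  have hvc : Continuous v := by fun_prop
  have hv0 {z : ℂ} (hz : u z < 1 / 3) : v z = 0 := by
    rw [hv]
    exact max_eq_left ((min_le_right _ _).trans (by linarith))
  have hv1 {z : ℂ} (hz : 2 / 3 < u z) : v z = 1 := by
    simp only [hv]
    rw [min_eq_left (by linarith), max_eq_right zero_le_one]
  -- `G` interpolates, through the logarithm `l` of `z - a` on `U`, between `1` on `A` and `z - a`
  -- on `B`. It is continuous without zeros on the plane, so it has a logarithm, which is impossible
  -- on a large circle around `a`.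
  set G : ℂ → ℂ := fun z =>
    if z ∈ U then Complex.exp (v z * l z) else if z ∈ A then 1 else z - a with hG
  have hGA {z : ℂ} (hz : u z < 1 / 3) : G z = 1 := by
    simp only [hG, hv0 hz]
    split_ifs with h1 h2
    · simp
    · rfl
    · exfalso
      have : z ∈ A ∪ B := by rw [hcup]; exact h1
      have hzu := hu1 (this.resolve_left h2)
      simp only [Pi.one_apply] at hzu
      linarith
  have hGB {z : ℂ} (hz : 2 / 3 < u z) : G z = z - a := by
    simp only [hG, hv1 hz]
    split_ifs with h1 h2
    · simpa using hexp h1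
    · have hzu := hu0 h2
      simp only [Pi.zero_apply] at hzu
      linarith
    · rfl
  have hGc : Continuous G := by
    rw [continuous_iff_continuousAt]
    intro z
    by_cases hz : z ∈ U
    · have : ContinuousOn (fun z => Complex.exp (v z * l z)) U := by
        have := Complex.continuous_ofReal.comp hvc
        exact Complex.continuous_exp.comp_continuousOn (this.continuousOn.mul hl)
      refine (this.continuousAt (hU.mem_nhds hz)).congr ?_
      filter_upwards [hU.mem_nhds hz] with w hw
      simp [hG, hw]
    · have hz' : z ∈ A ∪ B := by rw [hcup]; exact hz
      rcases hz' with hz' | hz'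
      · have hlt : u z < 1 / 3 := by
          have := hu0 hz'; simp only [Pi.zero_apply] at this; linarith
        refine (continuousAt_const (y := (1 : ℂ))).congr ?_
        filter_upwards [(isOpen_lt u.continuous continuous_const).mem_nhds hlt] with w hw
        exact (hGA hw).symm
      · have hlt : 2 / 3 < u z := by
          have := hu1 hz'; simp only [Pi.one_apply] at this; linarith
        refine (ContinuousAt.congr (f := fun z : ℂ => z - a) (by fun_prop) ?_)
        filter_upwards [(isOpen_lt continuous_const u.continuous).mem_nhds hlt] with w hw
        exact (hGB hw).symm
  have hG0 : ∀ z, G z ≠ 0 := by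
    intro z
    simp only [hG]
    split_ifs with h1 h2
    · exact Complex.exp_ne_zero _
    · exact one_ne_zero
    · rw [sub_ne_zero]
      rintro rfl
      exact h2 ha
  obtain ⟨θ, hθ, hθG⟩ := exists_continuous_log hGc hG0
  refine false_of_log_on_circle hθ (a := a) (ρ := |R| + ‖a‖) fun t => ?_
  have hmem : a + ((|R| + ‖a‖ : ℝ) : ℂ) * Complex.exp (t * Complex.I) ∈ B := by
    apply hR
    have h1 : ‖((|R| + ‖a‖ : ℝ) : ℂ) * Complex.exp (t * Complex.I)‖ = |R| + ‖a‖ := by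
      rw [norm_mul, Complex.norm_exp_ofReal_mul_I, mul_one, Complex.norm_real, Real.norm_eq_abs,
        abs_of_nonneg (by positivity)]
    have h2 := norm_sub_le (a + ((|R| + ‖a‖ : ℝ) : ℂ) * Complex.exp (t * Complex.I)) a
    rw [add_sub_cancel_left, h1] at h2
    linarith [le_abs_self R]
  have hgt : 2 / 3 < u (a + ((|R| + ‖a‖ : ℝ) : ℂ) * Complex.exp (t * Complex.I)) := by
    have := hu1 hmem; simp only [Pi.one_apply] at this; linarith
  rw [hθG, hGB hgt, add_sub_cancel_left]

/-- Used to put all points near infinity on one side of a separation of the complement. -/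
lemma isPreconnected_norm_ge (R : ℝ) : IsPreconnected {z : ℂ | R ≤ ‖z‖} := by
  have h1 : IsPreconnected (Metric.sphere (0 : ℂ) 1 ×ˢ Set.Ici R) :=
    (isPreconnected_sphere (by simp) 0 1).prod isPreconnected_Ici
  have h2 := h1.image (fun p : ℂ × ℝ => (p.2 : ℂ) * p.1) (by fun_prop)
  convert h2 using 1
  ext z
  simp only [Set.mem_ofPred_eq, Set.mem_image, Set.mem_prod, mem_sphere_zero_iff_norm, Set.mem_Ici,
    Prod.exists]
  constructor
  · intro hz
    rcases eq_or_ne z 0 with rfl | hz0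
    · refine ⟨1, 0, ⟨by simp, ?_⟩, by simp⟩
      simpa using hz
    · refine ⟨z / ‖z‖, ‖z‖, ⟨by simp [hz0], hz⟩, ?_⟩
      have : (‖z‖ : ℂ) ≠ 0 := by simpa using hz0
      field_simp
  · rintro ⟨w, t, ⟨hw, ht⟩, rfl⟩
    rw [norm_mul, hw, mul_one, Complex.norm_real, Real.norm_eq_abs]
    exact ht.trans (le_abs_self t)

/-- The complement of a bounded simply connected open subset of the plane is connected. -/
lemma isPreconnected_compl {U : Set ℂ} (hU : IsOpen U) (hUs : IsSimplyConnected U)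
    (hUb : Bornology.IsBounded U) : IsPreconnected Uᶜ := by
  obtain ⟨R, hR0, hR⟩ := hUb.exists_pos_norm_lt
  have hout : {z : ℂ | R ≤ ‖z‖} ⊆ Uᶜ := fun z hz hzU => not_lt.mpr hz (hR z hzU)
  have hne : ((R : ℂ)) ∈ {z : ℂ | R ≤ ‖z‖} := by
    simp [abs_of_pos hR0]
  rw [isPreconnected_closed_iff]
  intro t t' ht ht' hsub h1 h2
  by_contra hempty
  rw [Set.not_nonempty_iff_eq_empty] at hempty
  have hdisj : Disjoint (Uᶜ ∩ t) (Uᶜ ∩ t') := by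
    rw [Set.disjoint_left]
    rintro z ⟨hz, hzt⟩ ⟨_, hzt'⟩
    have : z ∈ Uᶜ ∩ (t ∩ t') := ⟨hz, hzt, hzt'⟩
    rw [hempty] at this
    exact this
  have hA := hU.isClosed_compl.inter ht
  have hB := hU.isClosed_compl.inter ht'
  have hcup : (Uᶜ ∩ t) ∪ (Uᶜ ∩ t') = Uᶜ := by
    rw [← Set.inter_union_distrib_left, Set.inter_eq_left]
    exact hsub
  have side : {z : ℂ | R ≤ ‖z‖} ⊆ Uᶜ ∩ t ∨ {z : ℂ | R ≤ ‖z‖} ⊆ Uᶜ ∩ t' := by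
    refine (isPreconnected_iff_subset_of_disjoint_closed.mp
      (isPreconnected_norm_ge R)) _ _ hA hB ?_ ?_
    · rw [hcup]; exact hout
    · rw [hdisj.inter_eq, Set.inter_empty]
  rcases side with hs | hs
  · obtain ⟨b, hb⟩ := h2
    exact false_of_bounded_part_of_compl hU hUs hB hA hdisj.symm (by rw [Set.union_comm, hcup]) hb
      fun z hz => hs hz
  · obtain ⟨a, ha⟩ := h1
    exact false_of_bounded_part_of_compl hU hUs hA hB hdisj hcup ha fun z hz => hs hz

/-- The plane is unicoherent: an open connected set with connected complement has connected
frontier. -/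
lemma isPreconnected_frontier_of_compl {U : Set ℂ} (hUc : IsPreconnected U)
    (hUc' : IsPreconnected Uᶜ) : IsPreconnected (frontier U) := by
  classical
  rw [isPreconnected_closed_iff]
  rintro t t' ht ht' hsub ⟨a, ha, hat⟩ ⟨b, hb, hbt⟩
  by_contra hempty
  rw [Set.not_nonempty_iff_eq_empty] at hempty
  have hdisj : Disjoint (frontier U ∩ t) (frontier U ∩ t') := by
    rw [Set.disjoint_left]
    rintro z ⟨hz, hzt⟩ ⟨_, hzt'⟩
    have : z ∈ frontier U ∩ (t ∩ t') := ⟨hz, hzt, hzt'⟩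
    rw [hempty] at this
    exact this
  obtain ⟨u, hu0, hu1, _⟩ := exists_continuous_zero_one_of_isClosed
    (isClosed_frontier.inter ht) (isClosed_frontier.inter ht') hdisj
  have hfr : ∀ z ∈ frontier U, Complex.exp (Real.pi * Complex.I * u z) =
      Complex.exp (-(Real.pi * Complex.I * u z)) := by
    intro z hz
    rcases hsub hz with h | h
    · have := hu0 ⟨hz, h⟩
      simp only [Pi.zero_apply] at this
      simp [this]
    · have := hu1 ⟨hz, h⟩
      simp only [Pi.one_apply] at this
      simp [this, Complex.exp_neg, Complex.exp_pi_mul_I]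
  have huc : Continuous fun z : ℂ => (u z : ℂ) := Complex.continuous_ofReal.comp u.continuous
  -- The two branches agree on the frontier because `u` is `0` or `1` there and `exp (πi) = exp
  -- (-πi)`.
  have hgc : Continuous fun z => if z ∈ U then Complex.exp (Real.pi * Complex.I * u z)
      else Complex.exp (-(Real.pi * Complex.I * u z)) := by
    refine Continuous.if (p := fun z => z ∈ U) hfr ?_ ?_
    · exact Complex.continuous_exp.comp (continuous_const.mul huc)
    · exact Complex.continuous_exp.comp (continuous_const.mul huc).neg
  obtain ⟨θ, hθ, hθg⟩ := exists_continuous_log hgc fun z => by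
    split_ifs <;> exact Complex.exp_ne_zero _
  have hin : ∀ z ∈ closure U, Complex.exp (θ z - Real.pi * Complex.I * u z) = 1 := by
    intro z hz
    rw [Complex.exp_sub, hθg, div_eq_one_iff_eq (Complex.exp_ne_zero _)]
    split_ifs with h
    · rfl
    · exact (hfr z ⟨hz, fun hi => h (interior_subset hi)⟩).symm
  have hout : ∀ z ∈ closure Uᶜ, Complex.exp (θ z + Real.pi * Complex.I * u z) = 1 := by
    intro z hz
    rw [← sub_neg_eq_add, Complex.exp_sub, hθg, div_eq_one_iff_eq (Complex.exp_ne_zero _)]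
    split_ifs with h
    · refine hfr z ⟨subset_closure h, ?_⟩
      rw [closure_compl] at hz
      exact hz
    · rfl
  have haz := hu0 ⟨ha, hat⟩
  have hbz := hu1 ⟨hb, hbt⟩
  simp only [Pi.zero_apply, Pi.one_apply] at haz hbz
  have hfrc : frontier U ⊆ closure Uᶜ := fun z hz => by rw [closure_compl]; exact hz.2
  -- From `a` to `b` the logarithm `θ` changes by `πi` along `closure U` and by `-πi` along `closure
  -- Uᶜ`.
  have e1 := eq_of_exp_eq_const hUc.closure
    (hθ.sub (continuous_const.mul huc)).continuousOn hin ha.1 hb.1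
  have e2 := eq_of_exp_eq_const hUc'.closure
    (hθ.add (continuous_const.mul huc)).continuousOn hout (hfrc ha) (hfrc hb)
  simp only [Pi.sub_apply, Pi.add_apply, Pi.mul_apply, haz, hbz] at e1 e2
  have e3 : (Real.pi : ℂ) * Complex.I = 0 := by
    push_cast at e1 e2
    linear_combination (e1 - e2) / 2
  simp [Real.pi_ne_zero] at e3

/-- The frontier of a bounded simply connected open subset of the plane is connected. -/
theorem isPreconnected_frontier {Ω : Set (ℝ × ℝ)} (hΩ : IsOpen Ω) (hΩs : IsSimplyConnected Ω)
    (hΩb : Bornology.IsBounded Ω) : IsPreconnected (frontier Ω) := by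
  set e := Complex.equivRealProdCLM.symm.toHomeomorph
  have hs : IsSimplyConnected (e '' Ω) := e.isSimplyConnected_image.mpr hΩs
  have ho : IsOpen (e '' Ω) := e.isOpenMap Ω hΩ
  have hb : Bornology.IsBounded (e '' Ω) :=
    Complex.equivRealProdCLM.symm.lipschitz.isBounded_image hΩb
  have h1 := isPreconnected_frontier_of_compl hs.isPathConnected.isConnected.isPreconnected
    (isPreconnected_compl ho hs hb)
  rw [← e.image_frontier] at h1
  exact e.isPreconnected_image.mp h1

end TrigCurve

/-! ### The divergence theorem by thin layers, and vanishing flux. -/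

namespace TrigCurve

open MeasureTheory Filter Topology Set

/-- A smooth transition from `0` on `(-∞, 1]` to `1` on `[2, ∞)`. -/
def cutoff (t : ℝ) : ℝ := Real.smoothTransition (t - 1)

lemma cutoff_of_le {t : ℝ} (h : t ≤ 1) : cutoff t = 0 :=
  Real.smoothTransition.zero_of_nonpos (by linarith)

lemma cutoff_of_ge {t : ℝ} (h : 2 ≤ t) : cutoff t = 1 :=
  Real.smoothTransition.one_of_one_le (by linarith)

lemma cutoff_mem (t : ℝ) : 0 ≤ cutoff t ∧ cutoff t ≤ 1 :=
  ⟨Real.smoothTransition.nonneg _, Real.smoothTransition.le_one _⟩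

lemma contDiff_cutoff : ContDiff ℝ 1 cutoff :=
  (Real.smoothTransition.contDiff (n := 1)).comp (contDiff_id.sub contDiff_const)

lemma continuous_deriv_cutoff : Continuous (deriv cutoff) :=
  contDiff_cutoff.continuous_deriv le_rfl

lemma deriv_cutoff_nonneg (t : ℝ) : 0 ≤ deriv cutoff t :=
  Monotone.deriv_nonneg fun _ _ h => Real.smoothTransition.monotone (by linarith)

lemma deriv_cutoff_of_lt {t : ℝ} (h : t < 1) : deriv cutoff t = 0 := by
  have : cutoff =ᶠ[𝓝 t] fun _ => 0 := by
    filter_upwards [Iio_mem_nhds h] with s hs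
    exact cutoff_of_le (le_of_lt hs)
  rw [this.deriv_eq, deriv_const]

lemma deriv_cutoff_of_gt {t : ℝ} (h : 2 < t) : deriv cutoff t = 0 := by
  have : cutoff =ᶠ[𝓝 t] fun _ => 1 := by
    filter_upwards [Ioi_mem_nhds h] with s hs
    exact cutoff_of_ge (le_of_lt hs)
  rw [this.deriv_eq, deriv_const]

lemma exists_deriv_cutoff_le : ∃ C : ℝ, ∀ t, deriv cutoff t ≤ C := by
  obtain ⟨C, hC⟩ := (isCompact_Icc (a := (1 : ℝ)) (b := 2)).bddAbove_image
    continuous_deriv_cutoff.continuousOn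
  refine ⟨max C 0, fun t => ?_⟩
  by_cases h : t ∈ Icc (1 : ℝ) 2
  · exact (hC (mem_image_of_mem _ h)).trans (le_max_left _ _)
  · rw [mem_Icc, not_and_or, not_le, not_le] at h
    rcases h with h | h
    · rw [deriv_cutoff_of_lt h]; exact le_max_right _ _
    · rw [deriv_cutoff_of_gt h]; exact le_max_right _ _

variable {E : Type*} [NormedAddCommGroup E]

lemma integrableOn_of_continuous {Ω : Set (ℝ × ℝ)} (hb : Bornology.IsBounded Ω)
    {F : ℝ × ℝ → E} (hF : Continuous F) : IntegrableOn F Ω :=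
  (hF.continuousOn.integrableOn_compact hb.isCompact_closure).mono_set subset_closure

lemma exists_norm_le_of_continuous {Ω : Set (ℝ × ℝ)} (hb : Bornology.IsBounded Ω)
    {F : ℝ × ℝ → E} (hF : Continuous F) : ∃ M, 0 ≤ M ∧ ∀ r ∈ Ω, ‖F r‖ ≤ M := by
  obtain ⟨M, hM⟩ := hb.isCompact_closure.exists_bound_of_continuousOn hF.continuousOn
  exact ⟨max M 0, le_max_right _ _, fun r hr => (hM r (subset_closure hr)).trans (le_max_left _ _)⟩

variable [NormedSpace ℝ E]

/-- The integral of a derivative of a compactly supported function vanishes. -/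
lemma integral_fderiv_of_hasCompactSupport {H : ℝ × ℝ → E} (hH : ContDiff ℝ 1 H)
    (hc : HasCompactSupport H) (v : ℝ × ℝ) : ∫ r, fderiv ℝ H r v = 0 := by
  have hd : Continuous fun r => fderiv ℝ H r v :=
    (hH.continuous_fderiv one_ne_zero).clm_apply continuous_const
  have hdc : HasCompactSupport fun r => fderiv ℝ H r v :=
    (hc.fderiv ℝ).comp_left (g := fun L : (ℝ × ℝ) →L[ℝ] E => L v) rfl
  have := integral_smul_fderiv_eq_neg_fderiv_smul_of_integrable (μ := volume)
    (f := fun _ : ℝ × ℝ => (1 : ℝ)) (g := H) (v := v) (by simp)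
    (by simpa using hd.integrable_of_hasCompactSupport hdc)
    (by simpa using hH.continuous.integrable_of_hasCompactSupport hc)
    (fun _ _ => differentiableAt_const _) (fun r _ => hH.differentiable one_ne_zero r)
  simpa using this

/-- The density `N η'(N m)` concentrated near the zero set of `m`. -/
def layer (m : ℝ × ℝ → ℝ) (N : ℕ) (r : ℝ × ℝ) : ℝ := N * deriv cutoff (N * m r)

lemma layer_nonneg (m : ℝ × ℝ → ℝ) (N : ℕ) (r : ℝ × ℝ) : 0 ≤ layer m N r :=
  mul_nonneg (Nat.cast_nonneg N) (deriv_cutoff_nonneg _)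

lemma continuous_layer {m : ℝ × ℝ → ℝ} (hm : Continuous m) (N : ℕ) : Continuous (layer m N) :=
  continuous_const.mul (continuous_deriv_cutoff.comp (continuous_const.mul hm))

lemma fderiv_cutoff_smul {m : ℝ × ℝ → ℝ} (hm : ContDiff ℝ 1 m) {F : ℝ × ℝ → E}
    (hF : ContDiff ℝ 1 F) (N : ℕ) (r v : ℝ × ℝ) :
    fderiv ℝ (fun r => cutoff (N * m r) • F r) r v =
      cutoff (N * m r) • fderiv ℝ F r v + (layer m N r * fderiv ℝ m r v) • F r := by
  have h1 := ((hm.differentiable one_ne_zero r).hasFDerivAt).const_mul (N : ℝ)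
  have h2 : HasFDerivAt (fun r => cutoff (N * m r)) _ r :=
    ((contDiff_cutoff.differentiable one_ne_zero _).hasDerivAt).comp_hasFDerivAt r h1
  have h3 := h2.smul (hF.differentiable one_ne_zero r).hasFDerivAt
  have h4 : fderiv ℝ (fun r => cutoff (N * m r) • F r) r = _ := h3.fderiv
  rw [h4]
  simp [layer, smul_smul]
  congr 1
  ring

/-- A function cut off near the frontier of a region has derivatives of mean zero. -/
lemma setIntegral_fderiv_cutoff {Ω : Set (ℝ × ℝ)} (hΩ : IsOpen Ω) (hb : Bornology.IsBounded Ω)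
    {m : ℝ × ℝ → ℝ} (hm : ContDiff ℝ 1 m) (hm0 : ∀ r ∈ frontier Ω, m r = 0)
    {F : ℝ × ℝ → E} (hF : ContDiff ℝ 1 F) (N : ℕ) (v : ℝ × ℝ) :
    ∫ r in Ω, fderiv ℝ (fun r => cutoff (N * m r) • F r) r v = 0 := by
  set G : ℝ × ℝ → E := fun r => cutoff (N * m r) • F r with hG
  have hGc : ContDiff ℝ 1 G := (contDiff_cutoff.comp (contDiff_const.mul hm)).smul hF
  have hin : ∀ r ∈ Ω, Ω.indicator G =ᶠ[𝓝 r] G := fun r hr => by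
    filter_upwards [hΩ.mem_nhds hr] with s hs
    exact indicator_of_mem hs G
  -- The cutoff vanishes up to `1`, not just up to `0`, hence on a whole neighbourhood of the
  -- frontier; extension by zero therefore stays smooth.
  have hout : ∀ r, r ∉ Ω → Ω.indicator G =ᶠ[𝓝 r] fun _ => 0 := fun r hr => by
    by_cases hcl : r ∈ closure Ω
    · have hz : N * m r < 1 := by
        rw [hm0 r ⟨hcl, by rwa [hΩ.interior_eq]⟩, mul_zero]
        exact one_pos
      have ho : IsOpen {r | N * m r < 1} :=
        isOpen_lt (continuous_const.mul hm.continuous) continuous_const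
      filter_upwards [ho.mem_nhds hz] with s hs
      by_cases hsΩ : s ∈ Ω
      · rw [indicator_of_mem hsΩ, hG]
        simp only
        rw [cutoff_of_le (le_of_lt hs), zero_smul]
      · exact indicator_of_notMem hsΩ _
    · filter_upwards [isClosed_closure.isOpen_compl.mem_nhds hcl] with s hs
      exact indicator_of_notMem (fun h => hs (subset_closure h)) _
  have hH : ContDiff ℝ 1 (Ω.indicator G) := by
    rw [contDiff_iff_contDiffAt]
    intro r
    by_cases hr : r ∈ Ω
    · exact hGc.contDiffAt.congr_of_eventuallyEq (hin r hr)
    · exact contDiffAt_const.congr_of_eventuallyEq (hout r hr)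
  have hcs : HasCompactSupport (Ω.indicator G) :=
    HasCompactSupport.intro hb.isCompact_closure fun r hr =>
      indicator_of_notMem (fun h => hr (subset_closure h)) _
  rw [← integral_fderiv_of_hasCompactSupport hH hcs v, ← integral_indicator hΩ.measurableSet]
  refine integral_congr_ae (Eventually.of_forall fun r => ?_)
  by_cases hr : r ∈ Ω
  · simp only
    rw [indicator_of_mem hr, (hin r hr).fderiv_eq]
  · simp only
    rw [indicator_of_notMem hr, (hout r hr).fderiv_eq]
    simp

/-- The divergence theorem for a region bounded by the zero set of `m`, with the boundary integral
expressed as a limit over thin layers. -/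
lemma tendsto_setIntegral_layer {Ω : Set (ℝ × ℝ)} (hΩ : IsOpen Ω) (hb : Bornology.IsBounded Ω)
    {m : ℝ × ℝ → ℝ} (hm : ContDiff ℝ 1 m) (hm0 : ∀ r ∈ frontier Ω, m r = 0)
    (hmpos : ∀ r ∈ Ω, 0 < m r) {F : ℝ × ℝ → E} (hF : ContDiff ℝ 1 F) (v : ℝ × ℝ) :
    Tendsto (fun N : ℕ => ∫ r in Ω, (layer m N r * fderiv ℝ m r v) • F r) atTop
      (𝓝 (-∫ r in Ω, fderiv ℝ F r v)) := by
  have hFv : Continuous fun r => fderiv ℝ F r v :=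
    (hF.continuous_fderiv one_ne_zero).clm_apply continuous_const
  have hmv : Continuous fun r => fderiv ℝ m r v :=
    (hm.continuous_fderiv one_ne_zero).clm_apply continuous_const
  have hcut (N : ℕ) : Continuous fun r => cutoff (N * m r) :=
    contDiff_cutoff.continuous.comp (continuous_const.mul hm.continuous)
  have hsum (N : ℕ) : ∫ r in Ω, (layer m N r * fderiv ℝ m r v) • F r =
      -∫ r in Ω, cutoff (N * m r) • fderiv ℝ F r v := by
    have h := setIntegral_fderiv_cutoff hΩ hb hm hm0 hF N v
    simp only [fderiv_cutoff_smul hm hF] at h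
    rw [integral_add
      (integrableOn_of_continuous (F := fun r => cutoff (N * m r) • fderiv ℝ F r v) hb
        ((hcut N).smul hFv))
      (integrableOn_of_continuous (F := fun r => (layer m N r * fderiv ℝ m r v) • F r) hb
        (((continuous_layer hm.continuous N).mul hmv).smul hF.continuous))] at h
    exact eq_neg_of_add_eq_zero_right h
  simp only [hsum]
  refine Tendsto.neg ?_
  refine tendsto_integral_of_dominated_convergence (fun r => ‖fderiv ℝ F r v‖) (fun N => ?_) ?_
    (fun N => ?_) ?_
  · exact ((hcut N).smul hFv).aestronglyMeasurable
  · exact (integrableOn_of_continuous hb hFv).norm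
  · refine Eventually.of_forall fun r => ?_
    rw [norm_smul, Real.norm_eq_abs, abs_of_nonneg (cutoff_mem _).1]
    exact mul_le_of_le_one_left (norm_nonneg _) (cutoff_mem _).2
  -- Inside `Ω` one has `m r > 0`, so the cutoff at `r` is `1` once `N ≥ 2 / m r`.
  · refine (ae_restrict_iff' hΩ.measurableSet).mpr (Eventually.of_forall fun r hr => ?_)
    refine tendsto_const_nhds.congr' ?_
    obtain ⟨N₀, hN₀⟩ := exists_nat_gt (2 / m r)
    filter_upwards [eventually_ge_atTop N₀] with N hN
    have : 2 ≤ N * m r := by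
      rw [div_lt_iff₀ (hmpos r hr)] at hN₀
      have : (N₀ : ℝ) * m r ≤ N * m r :=
        mul_le_mul_of_nonneg_right (by exact_mod_cast hN) (hmpos r hr).le
      linarith
    rw [cutoff_of_ge this, one_smul]

/-- Functions vanishing on the frontier of a region, through the factor `m`, have derivatives of
mean zero over the region. -/
lemma setIntegral_fderiv_smul_eq_zero {Ω : Set (ℝ × ℝ)} (hΩ : IsOpen Ω)
    (hb : Bornology.IsBounded Ω) {m : ℝ × ℝ → ℝ} (hm : ContDiff ℝ 1 m)
    (hm0 : ∀ r ∈ frontier Ω, m r = 0) (hmpos : ∀ r ∈ Ω, 0 < m r) {G : ℝ × ℝ → E}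
    (hG : ContDiff ℝ 1 G) (v : ℝ × ℝ) : ∫ r in Ω, fderiv ℝ (fun r => m r • G r) r v = 0 := by
  have hmv : Continuous fun r => fderiv ℝ m r v :=
    (hm.continuous_fderiv one_ne_zero).clm_apply continuous_const
  obtain ⟨C, hC⟩ := exists_deriv_cutoff_le
  have h1 := tendsto_setIntegral_layer hΩ hb hm hm0 hmpos (hm.smul hG) v
  have h2 : Tendsto (fun N : ℕ => ∫ r in Ω, (layer m N r * fderiv ℝ m r v) • (m r • G r)) atTop
      (𝓝 (∫ r in Ω, (0 : E))) := by
    refine tendsto_integral_of_dominated_convergence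
      (fun r => 2 * C * ‖fderiv ℝ m r v‖ * ‖G r‖) (fun N => ?_) ?_ (fun N => ?_) ?_
    · exact (((continuous_layer hm.continuous N).mul hmv).smul
        (hm.continuous.smul hG.continuous)).aestronglyMeasurable
    · exact integrableOn_of_continuous hb ((continuous_const.mul hmv.norm).mul hG.continuous.norm)
    · refine (ae_restrict_iff' hΩ.measurableSet).mpr (Eventually.of_forall fun r hr => ?_)
      -- The derivative of the cutoff lives on `[1, 2]`, so the extra factor `m` compensates the
      -- growth `N` of the layer by `N * m r ≤ 2`.
      have hle : layer m N r * m r ≤ 2 * C := by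
        have hC0 : 0 ≤ C := (deriv_cutoff_nonneg 0).trans (hC 0)
        have hrw : layer m N r * m r = deriv cutoff (N * m r) * (N * m r) := by
          rw [layer]; ring
        rw [hrw]
        by_cases h : 2 < N * m r
        · rw [deriv_cutoff_of_gt h, zero_mul]; positivity
        · rw [mul_comm 2 C]
          exact mul_le_mul (hC _) (not_lt.mp h)
            (mul_nonneg (Nat.cast_nonneg N) (hmpos r hr).le) hC0
      rw [norm_smul, norm_smul, norm_mul, Real.norm_eq_abs, Real.norm_eq_abs (m r),
        abs_of_nonneg (layer_nonneg m N r), abs_of_pos (hmpos r hr)]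
      calc _ = (layer m N r * m r) * (‖fderiv ℝ m r v‖ * ‖G r‖) := by ring
        _ ≤ 2 * C * (‖fderiv ℝ m r v‖ * ‖G r‖) := by gcongr
        _ = _ := by ring
    · refine (ae_restrict_iff' hΩ.measurableSet).mpr (Eventually.of_forall fun r hr => ?_)
      refine tendsto_const_nhds.congr' ?_
      obtain ⟨N₀, hN₀⟩ := exists_nat_gt (2 / m r)
      filter_upwards [eventually_ge_atTop N₀] with N hN
      have : 2 < N * m r := by
        rw [div_lt_iff₀ (hmpos r hr)] at hN₀
        have : (N₀ : ℝ) * m r ≤ N * m r :=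
          mul_le_mul_of_nonneg_right (by exact_mod_cast hN) (hmpos r hr).le
        linarith
      rw [layer, deriv_cutoff_of_gt this, mul_zero, zero_mul, zero_smul]
  have h3 := tendsto_nhds_unique h1 h2
  rw [integral_zero, neg_eq_zero] at h3
  exact h3

open scoped Convolution in
/-- An open set whose indicator has no distributional gradient in a ball around a frontier point is
dense in that ball. -/
lemma ball_subset_closure_of_setIntegral_fderiv_eq_zero {Ω : Set (ℝ × ℝ)} (hΩ : IsOpen Ω)
    {r₀ : ℝ × ℝ} (hr₀ : r₀ ∈ closure Ω) {δ : ℝ} (hδ : 0 < δ)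
    (h : ∀ χ : ℝ × ℝ → ℝ, ContDiff ℝ 1 χ → tsupport χ ⊆ Metric.ball r₀ δ →
      HasCompactSupport χ → ∀ v, ∫ r in Ω, fderiv ℝ χ r v = 0) :
    Metric.ball r₀ δ ⊆ closure Ω := by
  intro r₂ hr₂
  by_contra hcl
  obtain ⟨r₁, hr₁, hr₁Ω⟩ := mem_closure_iff.mp hr₀ _ Metric.isOpen_ball (Metric.mem_ball_self hδ)
  obtain ⟨ρ₁, hρ₁, hsub₁⟩ := Metric.isOpen_iff.mp hΩ r₁ hr₁Ω
  obtain ⟨ρ₂, hρ₂, hsub₂⟩ := Metric.isOpen_iff.mp isClosed_closure.isOpen_compl r₂ hcl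
  rw [Metric.mem_ball] at hr₁ hr₂
  obtain ⟨ρ, hρ0, hρ⟩ : ∃ ρ > 0, ρ < min (min ρ₁ ρ₂) (min (δ - dist r₁ r₀) (δ - dist r₂ r₀)) :=
    exists_between (lt_min (lt_min hρ₁ hρ₂) (lt_min (by linarith) (by linarith)))
  simp only [lt_min_iff] at hρ
  obtain ⟨⟨l1, l2⟩, l3, l4⟩ := hρ
  -- The mollified indicator `u` is constant on the ball of radius `δ - ρ`; with `ρ` this small it
  -- is positive at `r₁`, inside `Ω`, and zero at `r₂`, off its closure.
  let ψ : ContDiffBump (0 : ℝ × ℝ) := ⟨ρ / 2, ρ, by linarith, by linarith⟩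
  have hψ : ContDiff ℝ 1 ψ := ψ.contDiff
  have hloc : LocallyIntegrable (Ω.indicator fun _ => (1 : ℝ)) volume :=
    (locallyIntegrable_const 1).indicator hΩ.measurableSet
  set u := (Ω.indicator fun _ => (1 : ℝ)) ⋆[ContinuousLinearMap.mul ℝ ℝ, volume] ψ with hu
  have hval (s : ℝ × ℝ) : u s = ∫ t in Ω, ψ (s - t) := by
    rw [hu, convolution_def, ← integral_indicator hΩ.measurableSet]
    refine integral_congr_ae (Eventually.of_forall fun t => ?_)
    by_cases ht : t ∈ Ω <;> simp [ht]
  have hder (s : ℝ × ℝ) := ψ.hasCompactSupport.hasFDerivAt_convolution_right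
    (ContinuousLinearMap.mul ℝ ℝ) hloc hψ s
  have hzero : ∀ s ∈ Metric.ball r₀ (δ - ρ), fderiv ℝ u s = 0 := by
    intro s hs
    rw [(hder s).fderiv]
    refine ContinuousLinearMap.ext fun v => ?_
    have hconv : ConvolutionExistsAt (Ω.indicator fun _ => (1 : ℝ)) (fderiv ℝ ψ) s
        ((ContinuousLinearMap.mul ℝ ℝ).precompR (ℝ × ℝ)) volume :=
      (ψ.hasCompactSupport.fderiv ℝ).convolutionExists_right _ hloc
        (hψ.continuous_fderiv one_ne_zero) s
    rw [convolution_def, ContinuousLinearMap.integral_apply hconv]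
    have hχ := h (fun t => ψ (s - t)) (hψ.comp (contDiff_const.sub contDiff_id)) ?_ ?_ v
    · have hcong : ∀ t, fderiv ℝ (fun t => ψ (s - t)) t v = -(fderiv ℝ ψ (s - t) v) := by
        intro t
        have h1 : HasFDerivAt (fun t : ℝ × ℝ => s - t) (-(ContinuousLinearMap.id ℝ (ℝ × ℝ))) t :=
          (hasFDerivAt_id t).const_sub s
        have h2 := ((hψ.differentiable one_ne_zero (s - t)).hasFDerivAt).comp t h1
        have h3 : fderiv ℝ (fun t => ψ (s - t)) t = _ := h2.fderiv
        rw [h3]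
        simp
      simp only [hcong] at hχ
      rw [integral_neg, neg_eq_zero, ← integral_indicator hΩ.measurableSet] at hχ
      rw [zero_apply, ← hχ]
      refine integral_congr_ae (Eventually.of_forall fun t => ?_)
      by_cases ht : t ∈ Ω <;> simp [ht]
    · have hts : tsupport (fun t => ψ (s - t)) ⊆ Metric.closedBall s ρ := by
        refine closure_minimal (fun t ht => ?_) Metric.isClosed_closedBall
        have : s - t ∈ Function.support ψ := ht
        rw [ψ.support_eq, mem_ball_zero_iff] at this
        rw [Metric.mem_closedBall, dist_comm, dist_eq_norm]
        exact this.le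
      refine hts.trans fun t ht => ?_
      rw [Metric.mem_closedBall] at ht
      rw [Metric.mem_ball] at hs ⊢
      linarith [dist_triangle t s r₀]
    · refine HasCompactSupport.intro (isCompact_closedBall s ρ) fun t ht => ?_
      by_contra hne
      have : s - t ∈ Function.support ψ := hne
      rw [ψ.support_eq, mem_ball_zero_iff] at this
      apply ht
      rw [Metric.mem_closedBall, dist_comm, dist_eq_norm]
      exact this.le
  have hconst := Metric.isOpen_ball.is_const_of_fderiv_eq_zero
    (convex_ball r₀ (δ - ρ)).isPreconnected
    (fun s _ => ((hder s).differentiableAt).differentiableWithinAt) hzero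
    (x := r₁) (y := r₂) (by rw [Metric.mem_ball]; linarith) (by rw [Metric.mem_ball]; linarith)
  have hu₂ : u r₂ = 0 := by
    rw [hval]
    refine setIntegral_eq_zero_of_forall_eq_zero fun t ht => ?_
    by_contra hne
    have h1 : r₂ - t ∈ Function.support ψ := hne
    rw [ψ.support_eq, mem_ball_zero_iff, ← dist_eq_norm, dist_comm] at h1
    exact hsub₂ (Metric.mem_ball.mpr (lt_trans h1 l2)) (subset_closure ht)
  have hu₁ : 0 < u r₁ := by
    have hall : u r₁ = ∫ t, ψ (r₁ - t) := by
      rw [hval]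
      refine setIntegral_eq_integral_of_forall_compl_eq_zero fun t ht => ?_
      by_contra hne
      have h1 : r₁ - t ∈ Function.support ψ := hne
      rw [ψ.support_eq, mem_ball_zero_iff, ← dist_eq_norm, dist_comm] at h1
      exact ht (hsub₁ (Metric.mem_ball.mpr (lt_trans h1 l1)))
    rw [hall, integral_sub_left_eq_self (fun t => ψ t) volume r₁]
    exact ψ.integral_pos
  rw [show u r₁ = u r₂ from hconst, hu₂] at hu₁
  exact lt_irrefl _ hu₁

/-- If the flux of `h ∇m` through the zero set `frontier Ω` of `m` vanishes, where `h ≥ 0` near the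
frontier, then `h ∇m` vanishes on the frontier. -/
lemma fderiv_eq_zero_of_flux_eq_zero {Ω : Set (ℝ × ℝ)} (hΩ : IsOpen Ω)
    (hb : Bornology.IsBounded Ω) {m : ℝ × ℝ → ℝ} (hm : ContDiff ℝ 2 m)
    (hm0 : ∀ r ∈ frontier Ω, m r = 0) (hmpos : ∀ r ∈ Ω, 0 < m r) {s g : ℝ × ℝ → ℝ}
    (hs : ContDiff ℝ 1 s) (hs0 : ∀ r, 0 ≤ s r) (hg : ContDiff ℝ 1 g)
    (hgpos : ∀ r ∈ frontier Ω, 0 < g r)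
    (hflux : (∫ r in Ω, fderiv ℝ (fun r => s r * g r * fderiv ℝ m r (1, 0)) r (1, 0)) +
      ∫ r in Ω, fderiv ℝ (fun r => s r * g r * fderiv ℝ m r (0, 1)) r (0, 1) = 0) :
    ∀ r ∈ frontier Ω, s r ≠ 0 → fderiv ℝ m r = 0 := by
  intro r₀ hr₀ hsr₀
  by_contra hgrad
  have hm1 : ContDiff ℝ 1 m := hm.of_le (by norm_num)
  have hmv (v : ℝ × ℝ) : ContDiff ℝ 1 fun r => fderiv ℝ m r v :=
    (hm.fderiv_right (m := 1) (by norm_num)).clm_apply contDiff_const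
  set q : ℝ × ℝ → ℝ := fun r =>
    s r * g r * (fderiv ℝ m r (1, 0) ^ 2 + fderiv ℝ m r (0, 1) ^ 2) with hq
  have hqc : Continuous q := (hs.continuous.mul hg.continuous).mul
    (((hmv _).continuous.pow 2).add ((hmv _).continuous.pow 2))
  have hq0 : 0 < q r₀ := by
    refine mul_pos (mul_pos ((hs0 r₀).lt_of_ne' hsr₀) (hgpos r₀ hr₀)) ?_
    by_contra hle
    have h1 : fderiv ℝ m r₀ (1, 0) = 0 := by
      nlinarith [sq_nonneg (fderiv ℝ m r₀ (1, 0)), sq_nonneg (fderiv ℝ m r₀ (0, 1))]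
    have h2 : fderiv ℝ m r₀ (0, 1) = 0 := by
      nlinarith [sq_nonneg (fderiv ℝ m r₀ (1, 0)), sq_nonneg (fderiv ℝ m r₀ (0, 1))]
    refine hgrad (ContinuousLinearMap.ext fun v => ?_)
    have : v = v.1 • ((1, 0) : ℝ × ℝ) + v.2 • ((0, 1) : ℝ × ℝ) := by ext <;> simp
    rw [this, map_add, map_smul, map_smul, h1, h2]
    simp
  have hlayer : Tendsto (fun N : ℕ => ∫ r in Ω, layer m N r * q r) atTop (𝓝 0) := by
    have t1 := tendsto_setIntegral_layer hΩ hb hm1 hm0 hmpos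
      ((hs.mul hg).mul (hmv (1, 0))) (1, 0)
    have t2 := tendsto_setIntegral_layer hΩ hb hm1 hm0 hmpos
      ((hs.mul hg).mul (hmv (0, 1))) (0, 1)
    have t3 := t1.add t2
    have hz : (-∫ r in Ω, fderiv ℝ (fun r => s r * g r * fderiv ℝ m r (1, 0)) r (1, 0)) +
      (-∫ r in Ω, fderiv ℝ (fun r => s r * g r * fderiv ℝ m r (0, 1)) r (0, 1)) = 0 := by
      linarith
    rw [show (0 : ℝ) = _ from hz.symm]
    refine t3.congr fun N => ?_
    rw [← integral_add]
    · refine integral_congr_ae (Eventually.of_forall fun r => ?_)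
      simp only [hq, smul_eq_mul]
      ring
    · exact integrableOn_of_continuous hb (((continuous_layer hm.continuous N).mul
        (hmv _).continuous).smul ((hs.continuous.mul hg.continuous).mul (hmv _).continuous))
    · exact integrableOn_of_continuous hb (((continuous_layer hm.continuous N).mul
        (hmv _).continuous).smul ((hs.continuous.mul hg.continuous).mul (hmv _).continuous))
  -- `g` may be negative inside `Ω`, but only where `m` is bounded below by some `ε > 0`; the layer
  -- avoids that part once `N > 2 / ε`.
  obtain ⟨N₀, hN₀⟩ : ∃ N₀ : ℕ, ∀ N ≥ N₀, ∀ r ∈ Ω, 0 ≤ layer m N r * q r := by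
    have hK : IsCompact (closure Ω ∩ {r | g r ≤ 0}) :=
      hb.isCompact_closure.inter_right (isClosed_le hg.continuous continuous_const)
    obtain ⟨ε, hε, hle⟩ : ∃ ε > 0, ∀ r ∈ closure Ω ∩ {r | g r ≤ 0}, ε ≤ m r := by
      rcases (closure Ω ∩ {r | g r ≤ 0}).eq_empty_or_nonempty with he | hne
      · exact ⟨1, one_pos, fun r hr => by rw [he] at hr; exact hr.elim⟩
      · obtain ⟨r, hr, hmin⟩ := hK.exists_isMinOn hne hm.continuous.continuousOn
        refine ⟨m r, ?_, fun r' hr' => hmin hr'⟩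
        by_cases hrΩ : r ∈ Ω
        · exact hmpos r hrΩ
        · exact absurd (hgpos r ⟨hr.1, by rwa [hΩ.interior_eq]⟩) (not_lt.mpr hr.2)
    obtain ⟨N₀, hN₀⟩ := exists_nat_gt (2 / ε)
    refine ⟨N₀, fun N hN r hr => ?_⟩
    by_cases hgr : g r ≤ 0
    · have h1 := hle r ⟨subset_closure hr, hgr⟩
      have h2 : 2 < N * m r := by
        rw [div_lt_iff₀ hε] at hN₀
        have : (N₀ : ℝ) * ε ≤ N * m r :=
          mul_le_mul (by exact_mod_cast hN) h1 hε.le (Nat.cast_nonneg N)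
        linarith
      rw [layer, deriv_cutoff_of_gt h2, mul_zero, zero_mul]
    · refine mul_nonneg (layer_nonneg m N r) ?_
      exact mul_nonneg (mul_nonneg (hs0 r) (not_le.mp hgr).le) (by positivity)
  obtain ⟨δ, hδ, hball⟩ : ∃ δ > 0, ∀ r ∈ Metric.ball r₀ δ, q r₀ / 2 ≤ q r := by
    have ho : IsOpen {r | q r₀ / 2 < q r} := isOpen_lt continuous_const hqc
    obtain ⟨δ, hδ, hsub⟩ := Metric.isOpen_iff.mp ho r₀ (show q r₀ / 2 < q r₀ by linarith)
    exact ⟨δ, hδ, fun r hr => le_of_lt (hsub hr)⟩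
  -- Where `q` is bounded below, the layer integral of `q` dominates that of any test function. So
  -- the indicator of `Ω` has no gradient near `r₀`, `Ω` is dense there, `m ≥ 0` there, and `r₀` is
  -- a local minimum of `m`.
  have hdense := ball_subset_closure_of_setIntegral_fderiv_eq_zero hΩ
    (frontier_subset_closure hr₀) hδ fun χ hχ hsupp _ v => by
      have t1 := tendsto_setIntegral_layer hΩ hb hm1 hm0 hmpos hχ v
      obtain ⟨M, hM0, hM⟩ := exists_norm_le_of_continuous hb
        ((hmv v).continuous.mul hχ.continuous)
      have t2 : Tendsto (fun N : ℕ => ∫ r in Ω, (layer m N r * fderiv ℝ m r v) • χ r) atTop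
          (𝓝 0) := by
        refine squeeze_zero_norm' (a := fun N => (M / (q r₀ / 2)) * ∫ r in Ω, layer m N r * q r)
          ?_ (by simpa using hlayer.const_mul (M / (q r₀ / 2)))
        filter_upwards [eventually_ge_atTop N₀] with N hN
        rw [← integral_const_mul]
        refine norm_integral_le_of_norm_le
          (integrableOn_of_continuous hb
            (continuous_const.mul ((continuous_layer hm.continuous N).mul hqc)))
          ((ae_restrict_iff' hΩ.measurableSet).mpr (Eventually.of_forall fun r hr => ?_))
        by_cases hrB : r ∈ Metric.ball r₀ δ
        · have h1 : ‖fderiv ℝ m r v * χ r‖ ≤ M := hM r hr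
          rw [smul_eq_mul, mul_assoc, norm_mul, Real.norm_eq_abs,
            abs_of_nonneg (layer_nonneg m N r)]
          calc layer m N r * ‖fderiv ℝ m r v * χ r‖ ≤ layer m N r * M :=
                mul_le_mul_of_nonneg_left h1 (layer_nonneg m N r)
            _ = layer m N r * (M / (q r₀ / 2) * (q r₀ / 2)) := by
                rw [div_mul_cancel₀ _ (by linarith)]
            _ ≤ layer m N r * (M / (q r₀ / 2) * q r) := by
                refine mul_le_mul_of_nonneg_left ?_ (layer_nonneg m N r)
                exact mul_le_mul_of_nonneg_left (hball r hrB) (by positivity)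
            _ = _ := by ring
        · have : χ r = 0 := image_eq_zero_of_notMem_tsupport fun h => hrB (hsupp h)
          rw [this, smul_zero, norm_zero]
          exact mul_nonneg (by positivity) (hN₀ N hN r hr)
      have t3 := tendsto_nhds_unique t1 t2
      exact neg_eq_zero.mp t3
  refine hgrad (IsLocalMin.fderiv_eq_zero ?_)
  filter_upwards [Metric.ball_mem_nhds r₀ hδ] with r hr
  rw [hm0 r₀ hr₀]
  have hcl : closure Ω ⊆ {r | 0 ≤ m r} :=
    closure_minimal (fun r hr => (hmpos r hr).le) (isClosed_le continuous_const hm.continuous)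
  exact hcl (hdense hr)

end TrigCurve

/-! ### Real forms of minimal polynomials, region fluxes and the annihilation equations. -/

namespace TrigCurve

open MeasureTheory Filter Topology Set

/-- A nowhere zero continuous function on a preconnected set has constant sign. -/
lemma pos_or_neg_of_isPreconnected {X : Type*} [TopologicalSpace X] {s : Set X}
    (hs : IsPreconnected s) {f : X → ℝ} (hf : ContinuousOn f s) (h0 : ∀ x ∈ s, f x ≠ 0) :
    (∀ x ∈ s, 0 < f x) ∨ ∀ x ∈ s, f x < 0 := by
  by_contra! h
  obtain ⟨⟨x, hx, hfx⟩, y, hy, hfy⟩ := h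
  obtain ⟨z, hz, hfz⟩ := hs.intermediate_value hx hy hf ⟨hfx, hfy⟩
  exact h0 z hz hfz

lemma isBounded_of_subset_unitSquare {Ω : Set (ℝ × ℝ)} (h : Ω ⊆ unitSquare) :
    Bornology.IsBounded Ω :=
  ((Metric.isBounded_Icc (0 : ℝ) 1).prod (Metric.isBounded_Icc (0 : ℝ) 1)).subset h

namespace IsMinimalPoly

variable {μ : TrigPoly} {Ω : Set (ℝ × ℝ)}

lemma eval_ne_zero_of_mem (h : IsMinimalPoly μ (frontier Ω)) (hΩ : IsOpen Ω)
    (hsub : Ω ⊆ unitSquare) {r : ℝ × ℝ} (hr : r ∈ Ω) : μ.eval r ≠ 0 := by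
  intro h0
  have h1 : r ∈ frontier Ω := by
    rw [← h.zeroSet_eq]
    exact ⟨hsub hr, h0⟩
  rw [hΩ.frontier_eq] at h1
  exact h1.2 hr

lemma ne_zero (h : IsMinimalPoly μ (frontier Ω)) (hΩ : IsOpen Ω) (hsub : Ω ⊆ unitSquare)
    (hne : Ω.Nonempty) : μ ≠ 0 := by
  rintro rfl
  obtain ⟨r, hr⟩ := hne
  exact h.eval_ne_zero_of_mem hΩ hsub hr (eval_zero r)

end IsMinimalPoly

/-- A trigonometric polynomial `μ = w m` with a nowhere vanishing smooth factor `w` and a real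
factor `m` which is positive on `Ω` and vanishes on the frontier of `Ω`. The phase `γ` of `μ` is
that of `w`. -/
structure RealForm (μ : TrigPoly) (Ω : Set (ℝ × ℝ)) where
  /-- The phase. -/
  γ : TrigPoly
  /-- The nowhere vanishing factor. -/
  w : ℝ × ℝ → ℂ
  /-- The real factor. -/
  m : ℝ × ℝ → ℝ
  conjPoly_eq : conjPoly μ = γ * μ
  γ_mul : γ * conjPoly γ = 1
  contDiff_w : ContDiff ℝ 2 w
  contDiff_m : ContDiff ℝ 2 m
  w_ne_zero : ∀ r, w r ≠ 0
  conj_w : ∀ r, starRingEnd ℂ (w r) = γ.eval r * w r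
  eval_eq : ∀ r, μ.eval r = w r * m r
  m_frontier : ∀ r ∈ frontier Ω, m r = 0
  m_pos : ∀ r ∈ Ω, 0 < m r

lemma IsMinimalPoly.nonempty_realForm {μ : TrigPoly} {Ω : Set (ℝ × ℝ)}
    (h : IsMinimalPoly μ (frontier Ω)) (hΩ : IsOpen Ω) (hsub : Ω ⊆ unitSquare)
    (hconn : IsConnected Ω) : Nonempty (RealForm μ Ω) := by
  obtain ⟨γ, hγ, hu⟩ := h.exists_phase (h.ne_zero hΩ hsub hconn.nonempty)
  obtain ⟨k, c, hc, hγk⟩ := eq_single_of_mul_conjPoly_eq_one hu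
  -- Half the phase of the monomial `γ`, so `γ = e^{2iθ}` and `w = e^{-iθ}`. Half-integer
  -- frequencies may occur, which is why `w` is only a smooth function.
  set θ : ℝ × ℝ → ℝ := fun r => c.arg / 2 + Real.pi * ((k.1 : ℝ) * r.1 + (k.2 : ℝ) * r.2) with hθ
  set w : ℝ × ℝ → ℂ := fun r => Complex.exp (-(Complex.I * (θ r : ℂ))) with hw
  have hwsmooth : ContDiff ℝ 2 w := by
    refine ContDiff.cexp (contDiff_const.mul ?_).neg
    exact Complex.ofRealCLM.contDiff.comp (contDiff_const.add (contDiff_const.mul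
      ((contDiff_const.mul contDiff_fst).add (contDiff_const.mul contDiff_snd))))
  have hw0 (r) : w r ≠ 0 := Complex.exp_ne_zero _
  have hγe (r) : γ.eval r = Complex.exp (2 * (Complex.I * (θ r : ℂ))) := by
    have hce : c = Complex.exp (c.arg * Complex.I) := by
      have := Complex.norm_mul_exp_arg_mul_I c
      rw [hc, Complex.ofReal_one, one_mul] at this
      exact this.symm
    rw [hγk, eval_single, character]
    conv_lhs => rw [hce]
    rw [← Complex.exp_add]
    congr 1
    simp only [hθ]
    push_cast
    ring
  have hconjw (r) : starRingEnd ℂ (w r) = γ.eval r * w r := by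
    rw [hγe, hw]
    simp only
    rw [← Complex.exp_conj, ← Complex.exp_add]
    congr 1
    simp only [map_neg, map_mul, Complex.conj_I, Complex.conj_ofReal]
    ring
  have hww (r) : w r * starRingEnd ℂ (w r) = 1 := by
    rw [hconjw, hγe, hw]
    simp only
    rw [← Complex.exp_add, ← Complex.exp_add, ← Complex.exp_zero]
    congr 1
    ring
  set m : ℝ × ℝ → ℝ := fun r => (starRingEnd ℂ (w r) * μ.eval r).re with hm
  have hmsmooth : ContDiff ℝ 2 m := by
    have h1 : ContDiff ℝ 2 fun r => starRingEnd ℂ (w r) * μ.eval r :=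
      (Complex.conjCLE.contDiff.comp hwsmooth).mul ((contDiff_eval μ).of_le (by simp))
    exact Complex.reCLM.contDiff.comp h1
  have hmc (r) : (m r : ℂ) = starRingEnd ℂ (w r) * μ.eval r := by
    rw [hm]
    simp only
    rw [← Complex.conj_eq_iff_re, map_mul, Complex.conj_conj, hconjw, ← eval_conjPoly, hγ, eval_mul]
    ring
  have heval (r) : μ.eval r = w r * m r := by
    rw [hmc, ← mul_assoc, hww, one_mul]
  have hm0 : ∀ r ∈ frontier Ω, m r = 0 := fun r hr => by
    have : (m r : ℂ) = 0 := by rw [hmc, h.eval_eq_zero hr, mul_zero]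
    exact_mod_cast this
  have hmne : ∀ r ∈ Ω, m r ≠ 0 := fun r hr hz => by
    refine h.eval_ne_zero_of_mem hΩ hsub hr ?_
    rw [heval, hz, Complex.ofReal_zero, mul_zero]
  rcases pos_or_neg_of_isPreconnected hconn.isPreconnected hmsmooth.continuous.continuousOn hmne
    with hpos | hneg
  · exact ⟨⟨γ, w, m, hγ, hu, hwsmooth, hmsmooth, hw0, hconjw, heval, hm0, hpos⟩⟩
  · exact ⟨⟨γ, fun r => -w r, fun r => -m r, hγ, hu, hwsmooth.neg, hmsmooth.neg,
      fun r => neg_ne_zero.mpr (hw0 r), fun r => by rw [map_neg, hconjw, mul_neg],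
      fun r => by rw [heval]; push_cast; ring, fun r hr => by rw [hm0 r hr, neg_zero],
      fun r hr => neg_pos.mpr (hneg r hr)⟩⟩

/-- The flux `p ↦ ∫_Ω ∂ᵥ p` of trigonometric polynomials through the boundary of a region. -/
def regionFlux (Ω : Set (ℝ × ℝ)) (hb : Bornology.IsBounded Ω) (v : ℝ × ℝ) : TrigPoly →ₗ[ℂ] ℂ where
  toFun p := ∫ r in Ω, fderiv ℝ p.eval r v
  map_add' p q := by
    have hd (p : TrigPoly) : Differentiable ℝ p.eval := (contDiff_eval p).differentiable (by simp)
    have hc (p : TrigPoly) : Continuous fun r => fderiv ℝ p.eval r v :=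
      ((contDiff_eval p).continuous_fderiv (by simp)).clm_apply continuous_const
    rw [← integral_add (integrableOn_of_continuous hb (hc p)) (integrableOn_of_continuous hb (hc q))]
    refine integral_congr_ae (Eventually.of_forall fun r => ?_)
    have : (p + q).eval = p.eval + q.eval := by ext; simp
    simp only [this, fderiv_add (hd p r) (hd q r), add_apply]
  map_smul' c p := by
    have hd : Differentiable ℝ p.eval := (contDiff_eval p).differentiable (by simp)
    rw [RingHom.id_apply, smul_eq_mul, ← integral_const_mul]
    refine integral_congr_ae (Eventually.of_forall fun r => ?_)
    have : (c • p).eval = fun r => c * p.eval r := by ext; simp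
    simp only [this, fderiv_const_mul (hd r), smul_apply, smul_eq_mul]

lemma regionFlux_apply (Ω : Set (ℝ × ℝ)) (hb : Bornology.IsBounded Ω) (v : ℝ × ℝ) (p : TrigPoly) :
    regionFlux Ω hb v p = ∫ r in Ω, fderiv ℝ p.eval r v := rfl

/-- Multiples of a polynomial vanishing on the frontier have no flux. -/
lemma RealForm.regionFlux_mul_eq_zero {μ : TrigPoly} {Ω : Set (ℝ × ℝ)} (F : RealForm μ Ω)
    (hΩ : IsOpen Ω) (hb : Bornology.IsBounded Ω) (v : ℝ × ℝ) (q : TrigPoly) :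
    regionFlux Ω hb v (μ * q) = 0 := by
  have h := setIntegral_fderiv_smul_eq_zero hΩ hb (F.contDiff_m.of_le (by norm_num)) F.m_frontier
    F.m_pos (G := fun r => F.w r * q.eval r)
    ((F.contDiff_w.of_le (by norm_num)).mul ((contDiff_eval q).of_le (by simp))) v
  rw [regionFlux_apply, ← h]
  have : (μ * q).eval = fun r => F.m r • (F.w r * q.eval r) := by
    ext r
    rw [eval_mul, F.eval_eq, Complex.real_smul]
    ring
  rw [this]

lemma eq_sum_single {p : TrigPoly} {s : Finset (ℤ × ℤ)} (h : p.coeff.support ⊆ s) :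
    p = ∑ k ∈ s, p.coeff k • (AddMonoidAlgebra.single k 1 : TrigPoly) := by
  refine eval_injective ?_
  ext r
  rw [eval_eq_sum_of_subset p h, eval_eq_evalHom, map_sum]
  refine Finset.sum_congr rfl fun k _ => ?_
  rw [← eval_eq_evalHom, eval_smul, eval_single, one_mul]

lemma distDeriv_piecewiseConst {n : ℕ} (a : Fin n → ℂ) {Ω : Fin n → Set (ℝ × ℝ)}
    (hΩ : ∀ i, IsOpen (Ω i)) (hb : ∀ i, Bornology.IsBounded (Ω i)) (v : ℝ × ℝ) (p : TrigPoly) :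
    distDeriv (piecewiseConst a Ω) v p.eval = -∑ i, a i * regionFlux (Ω i) (hb i) v p := by
  have hc : Continuous fun r => fderiv ℝ p.eval r v :=
    ((contDiff_eval p).continuous_fderiv (by simp)).clm_apply continuous_const
  have hi (i : Fin n) : (fun r => (Ω i).indicator (fun _ => a i) r * fderiv ℝ p.eval r v) =
      (Ω i).indicator fun r => a i * fderiv ℝ p.eval r v := by
    ext r
    by_cases hr : r ∈ Ω i <;> simp [hr]
  rw [distDeriv]
  congr 1
  simp only [piecewiseConst, Finset.sum_mul]
  rw [integral_finsetSum]
  · refine Finset.sum_congr rfl fun i _ => ?_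
    rw [hi, integral_indicator (hΩ i).measurableSet, integral_const_mul, regionFlux_apply]
  · intro i _
    rw [hi, integrable_indicator_iff (hΩ i).measurableSet]
    exact integrableOn_of_continuous (hb i) (continuous_const.mul hc)

lemma fourierDeriv_latticeFreq (f : ℝ × ℝ → ℂ) (v : ℝ × ℝ) (k : ℤ × ℤ) :
    fourierDeriv f v (latticeFreq k) =
      distDeriv f v (TrigPoly.eval (AddMonoidAlgebra.single (-k) 1)) := by
  rw [fourierDeriv]
  congr 1
  ext r
  rw [eval_single, one_mul, character]
  congr 1
  simp only [latticeFreq, Prod.fst_neg, Prod.snd_neg]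
  push_cast
  ring

/-- The exponential at frequency `2π(l - k)` is the character of `k - l`; summing against `d`
assembles `d e_{-l}`. -/
lemma sum_mul_fourierDeriv {n : ℕ} (a : Fin n → ℂ) {Ω : Fin n → Set (ℝ × ℝ)}
    (hΩ : ∀ i, IsOpen (Ω i)) (hb : ∀ i, Bornology.IsBounded (Ω i)) (v : ℝ × ℝ) {d : TrigPoly}
    {Λ : Finset (ℤ × ℤ)} (hd : d.coeff.support ⊆ Λ) (l : ℤ × ℤ) :
    ∑ k ∈ Λ, d.coeff k * fourierDeriv (piecewiseConst a Ω) v (latticeFreq (l - k)) =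
      -∑ i, a i * regionFlux (Ω i) (hb i) v (d * AddMonoidAlgebra.single (-l) 1) := by
  have hexp : d * AddMonoidAlgebra.single (-l) 1 =
      ∑ k ∈ Λ, d.coeff k • (AddMonoidAlgebra.single (-(l - k)) 1 : TrigPoly) := by
    conv_lhs => rw [eq_sum_single hd]
    rw [Finset.sum_mul]
    refine Finset.sum_congr rfl fun k _ => ?_
    rw [smul_mul_assoc, AddMonoidAlgebra.single_mul_single, one_mul, neg_sub, sub_eq_add_neg]
  simp only [fourierDeriv_latticeFreq, distDeriv_piecewiseConst a hΩ hb, hexp, map_sum, map_smul,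
    smul_eq_mul, mul_neg, Finset.sum_neg_distrib, Finset.mul_sum]
  rw [Finset.sum_comm]
  congr 1
  exact Finset.sum_congr rfl fun i _ => Finset.sum_congr rfl fun k _ => by ring

/-- Solutions of the annihilation equations have no flux against trigonometric polynomials with
frequencies in a symmetric rectangle. -/
lemma SolvesAnnihilation.sum_regionFlux_eq_zero {n : ℕ} {a : Fin n → ℂ}
    {Ω : Fin n → Set (ℝ × ℝ)} (hΩ : ∀ i, IsOpen (Ω i)) (hb : ∀ i, Bornology.IsBounded (Ω i))
    {d : TrigPoly} {Λ : Finset (ℤ × ℤ)} {K L : ℕ} (hd : d.coeff.support ⊆ Λ)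
    (h : SolvesAnnihilation (piecewiseConst a Ω) Λ (freqRect K L) d.coeff) {φ : TrigPoly}
    (hφ : φ.coeff.support ⊆ freqRect K L) :
    (∑ i, a i * regionFlux (Ω i) (hb i) (1, 0) (d * φ) = 0) ∧
      ∑ i, a i * regionFlux (Ω i) (hb i) (0, 1) (d * φ) = 0 := by
  have main (v : ℝ × ℝ) (hv : ∀ l ∈ freqRect K L,
      ∑ k ∈ Λ, d.coeff k * fourierDeriv (piecewiseConst a Ω) v (latticeFreq (l - k)) = 0) :
      ∑ i, a i * regionFlux (Ω i) (hb i) v (d * φ) = 0 := by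
    have hexp : d * φ = ∑ k ∈ freqRect K L,
        φ.coeff k • (d * (AddMonoidAlgebra.single k 1 : TrigPoly)) := by
      conv_lhs => rw [eq_sum_single hφ]
      simp only [Finset.mul_sum, mul_smul_comm]
    simp only [hexp, map_sum, map_smul, smul_eq_mul, Finset.mul_sum]
    rw [Finset.sum_comm]
    refine Finset.sum_eq_zero fun k hk => ?_
    have hk' : -k ∈ freqRect K L := by
      rw [mem_freqRect] at hk ⊢
      simp only [Prod.fst_neg, Prod.snd_neg]
      omega
    have h1 := hv (-k) hk'
    rw [sum_mul_fourierDeriv a hΩ hb v hd, neg_neg, neg_eq_zero] at h1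
    calc _ = φ.coeff k * ∑ i, a i * regionFlux (Ω i) (hb i) v
          (d * AddMonoidAlgebra.single k 1) := by
            rw [Finset.mul_sum]
            exact Finset.sum_congr rfl fun i _ => by ring
      _ = 0 := by rw [h1, mul_zero]
  exact ⟨main _ fun l hl => (h l hl).1, main _ fun l hl => (h l hl).2⟩

/-- A solution with no flux through a curve vanishes on the curve. -/
lemma RealForm.eval_eq_zero_of_regionFlux {μ d g : TrigPoly} {Ω : Set (ℝ × ℝ)} (F : RealForm μ Ω)
    (hmin : IsMinimalPoly μ (frontier Ω)) (hμ : μ ≠ 0) (hΩ : IsOpen Ω)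
    (hb : Bornology.IsBounded Ω) (hfr : IsPreconnected (frontier Ω))
    (hg0 : ∀ r ∈ frontier Ω, g.eval r ≠ 0) {C : ℂ} (hC : ‖C‖ = 1)
    (hgμ : conjPoly (g * μ) = C • (g * μ))
    (hflux : ∀ v ∈ ({(1, 0), (0, 1)} : Set (ℝ × ℝ)),
      regionFlux Ω hb v (d * (conjPoly d * (g * multiplier (derivSymbol v) μ))) = 0) :
    ∀ r ∈ frontier Ω, d.eval r = 0 := by
  have hgγ : conjPoly g * F.γ = C • g := by
    refine mul_right_cancel₀ hμ ?_
    rw [mul_assoc, ← F.conjPoly_eq, ← conjPoly_mul, hgμ, smul_mul_assoc]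
  have hw1 : ContDiff ℝ 1 F.w := F.contDiff_w.of_le (by norm_num)
  have hm1 : ContDiff ℝ 1 F.m := F.contDiff_m.of_le (by norm_num)
  -- `κ` is a square root of `C`, up to sign; by `hgγ` it makes `κ w g` real. Connectedness of the
  -- frontier fixes the sign.
  obtain ⟨κ, b, hb1, hbeq, hbpos⟩ : ∃ (κ : ℂ) (b : ℝ × ℝ → ℝ), ContDiff ℝ 1 b ∧
      (∀ r, (b r : ℂ) = κ * F.w r * g.eval r) ∧ ∀ r ∈ frontier Ω, 0 < b r := by
    set κ : ℂ := Complex.exp ((C.arg / 2 : ℝ) * Complex.I) with hκ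
    have hκ2 : starRingEnd ℂ κ * C = κ := by
      have hCe : C = Complex.exp (C.arg * Complex.I) := by
        have := Complex.norm_mul_exp_arg_mul_I C
        rw [hC, Complex.ofReal_one, one_mul] at this
        exact this.symm
      conv_lhs => rw [hCe]
      rw [hκ, ← Complex.exp_conj, ← Complex.exp_add]
      congr 1
      simp only [map_mul, Complex.conj_I, Complex.conj_ofReal]
      push_cast
      ring
    set b : ℝ × ℝ → ℝ := fun r => (κ * F.w r * g.eval r).re with hbdef
    have hbs : ContDiff ℝ 1 b := Complex.reCLM.contDiff.comp
      ((contDiff_const.mul hw1).mul ((contDiff_eval g).of_le (by simp)))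
    have hbc (r) : (b r : ℂ) = κ * F.w r * g.eval r := by
      rw [hbdef]
      simp only
      rw [← Complex.conj_eq_iff_re, map_mul, map_mul, F.conj_w, ← eval_conjPoly]
      have h1 := congrArg (fun p : TrigPoly => p.eval r) hgγ
      simp only [eval_mul, eval_smul] at h1
      linear_combination starRingEnd ℂ κ * F.w r * h1 + F.w r * g.eval r * hκ2
    have hbne : ∀ r ∈ frontier Ω, b r ≠ 0 := fun r hr hz => by
      have h1 := hbc r
      rw [hz, Complex.ofReal_zero] at h1
      exact mul_ne_zero (mul_ne_zero (Complex.exp_ne_zero _) (F.w_ne_zero r)) (hg0 r hr) h1.symm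
    rcases pos_or_neg_of_isPreconnected hfr hbs.continuous.continuousOn hbne with hp | hn
    · exact ⟨κ, b, hbs, hbc, hp⟩
    · exact ⟨-κ, fun r => -b r, hbs.neg, fun r => by push_cast; rw [hbc]; ring,
        fun r hr => neg_pos.mpr (hn r hr)⟩
  set s : ℝ × ℝ → ℝ := fun r => Complex.normSq (d.eval r) with hs
  have hsc (r) : (s r : ℂ) = d.eval r * starRingEnd ℂ (d.eval r) := (Complex.mul_conj _).symm
  have hs1 : ContDiff ℝ 1 s := by
    have h1 : ContDiff ℝ 1 fun r => d.eval r * starRingEnd ℂ (d.eval r) :=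
      ((contDiff_eval d).of_le (by simp)).mul
        (Complex.conjCLE.contDiff.comp ((contDiff_eval d).of_le (by simp)))
    have h2 : s = fun r => (d.eval r * starRingEnd ℂ (d.eval r)).re := by
      ext r
      rw [← hsc, Complex.ofReal_re]
    rw [h2]
    exact Complex.reCLM.contDiff.comp h1
  have hfd (r v : ℝ × ℝ) : (multiplier (derivSymbol v) μ).eval r =
      F.w r * (fderiv ℝ F.m r v : ℝ) + F.m r * fderiv ℝ F.w r v := by
    have h1 : μ.eval = fun r => F.m r • F.w r := by
      ext r; rw [F.eval_eq, Complex.real_smul, mul_comm]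
    have h2 : HasFDerivAt (fun r => F.m r • F.w r) _ r :=
      ((hm1.differentiable one_ne_zero r).hasFDerivAt).smul
        (hw1.differentiable one_ne_zero r).hasFDerivAt
    rw [← fderiv_eval, h1, h2.fderiv]
    simp [Complex.real_smul]
    ring
  have hmv (v : ℝ × ℝ) : ContDiff ℝ 1 fun r => fderiv ℝ F.m r v :=
    (F.contDiff_m.fderiv_right (m := 1) (by norm_num)).clm_apply contDiff_const
  have hwv (v : ℝ × ℝ) : ContDiff ℝ 1 fun r => fderiv ℝ F.w r v :=
    (F.contDiff_w.fderiv_right (m := 1) (by norm_num)).clm_apply contDiff_const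
  -- Since `∂ᵥμ = w ∂ᵥm + m ∂ᵥw`, the given flux splits into that of `A`, built from `∂ᵥm`, and that
  -- of the multiple `m • B`, which vanishes.
  have hreal (v : ℝ × ℝ) (hv : v ∈ ({(1, 0), (0, 1)} : Set (ℝ × ℝ))) :
      ∫ r in Ω, fderiv ℝ (fun r => s r * b r * fderiv ℝ F.m r v) r v = 0 := by
    set A : ℝ × ℝ → ℝ := fun r => s r * b r * fderiv ℝ F.m r v with hA
    set B : ℝ × ℝ → ℂ := fun r =>
      ((s r * b r : ℝ) : ℂ) * ((F.w r)⁻¹ * fderiv ℝ F.w r v) with hB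
    have hA1 : ContDiff ℝ 1 A := (hs1.mul hb1).mul (hmv v)
    have hB1 : ContDiff ℝ 1 B := (Complex.ofRealCLM.contDiff.comp (hs1.mul hb1)).mul
      ((hw1.inv F.w_ne_zero).mul (hwv v))
    have hAc : ContDiff ℝ 1 fun r => (A r : ℂ) := Complex.ofRealCLM.contDiff.comp hA1
    have hmB : ContDiff ℝ 1 fun r => F.m r • B r := hm1.smul hB1
    have hfun : (κ • (d * (conjPoly d * (g * multiplier (derivSymbol v) μ)))).eval =
        fun r => (A r : ℂ) + F.m r • B r := by
      ext r
      rw [eval_smul, eval_mul, eval_mul, eval_mul, eval_conjPoly, hfd, hA, hB, Complex.real_smul]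
      simp only
      push_cast
      rw [hsc, hbeq]
      have := F.w_ne_zero r
      field_simp
    have h0 : regionFlux Ω hb v
        (κ • (d * (conjPoly d * (g * multiplier (derivSymbol v) μ)))) = 0 := by
      rw [map_smul, hflux v hv, smul_zero]
    rw [regionFlux_apply, hfun] at h0
    have hsplit (r) : fderiv ℝ (fun r => (A r : ℂ) + F.m r • B r) r v =
        ((fderiv ℝ A r v : ℝ) : ℂ) + fderiv ℝ (fun r => F.m r • B r) r v := by
      rw [fderiv_fun_add (hAc.differentiable one_ne_zero r) (hmB.differentiable one_ne_zero r),
        add_apply]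
      congr 1
      have : HasFDerivAt (fun r => (A r : ℂ)) _ r :=
        Complex.ofRealCLM.hasFDerivAt.comp r (hA1.differentiable one_ne_zero r).hasFDerivAt
      rw [this.fderiv]
      simp
    have hAv : Continuous fun r => ((fderiv ℝ A r v : ℝ) : ℂ) :=
      Complex.continuous_ofReal.comp
        ((hA1.continuous_fderiv one_ne_zero).clm_apply continuous_const)
    have hBv : Continuous fun r => fderiv ℝ (fun r => F.m r • B r) r v :=
      (hmB.continuous_fderiv one_ne_zero).clm_apply continuous_const
    simp only [hsplit] at h0
    rw [integral_add (integrableOn_of_continuous hb hAv) (integrableOn_of_continuous hb hBv),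
      setIntegral_fderiv_smul_eq_zero hΩ hb hm1 F.m_frontier F.m_pos hB1 v, add_zero,
      integral_complex_ofReal] at h0
    exact_mod_cast h0
  have hgrad := fderiv_eq_zero_of_flux_eq_zero hΩ hb F.contDiff_m F.m_frontier F.m_pos hs1
    (fun r => Complex.normSq_nonneg _) hb1 hbpos
    (by rw [hreal _ (Or.inl rfl), hreal _ (Or.inr rfl), add_zero])
  refine hmin.eval_eq_zero_of_mul_derivative hμ fun r hr => ?_
  by_cases hdr : d.eval r = 0
  · rw [hdr, zero_mul]
  · have h1 := hgrad r hr fun h => hdr (Complex.normSq_eq_zero.mp h)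
    have hv (v : ℝ × ℝ) : (multiplier (derivSymbol v) μ).eval r = 0 := by
      rw [hfd, h1, F.m_frontier r hr]
      simp
    have h2 := eval_multiplier_complexSymbol μ r
    rw [hv, hv, mul_zero, add_zero] at h2
    have h3 : (multiplier complexSymbol μ).eval r = 0 := by
      simpa [Real.pi_ne_zero] using h2
    rw [h3, mul_zero]

lemma zeroSet_prod {n : ℕ} (μ : Fin n → TrigPoly) :
    zeroSet (∏ i, μ i) = ⋃ i, zeroSet (μ i) := by
  ext r
  simp only [zeroSet, mem_ofPred_eq, eval_prod, Finset.prod_eq_zero_iff, Finset.mem_univ, true_and,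
    mem_iUnion]
  exact ⟨fun ⟨h, i, hi⟩ => ⟨i, h, hi⟩, fun ⟨i, h, hi⟩ => ⟨h, i, hi⟩⟩

lemma zeroSet_smul {c : ℂ} (hc : c ≠ 0) (p : TrigPoly) : zeroSet (c • p) = zeroSet p := by
  ext r
  simp [zeroSet, hc]

end TrigCurve

/-! ### The phase of the full product and the proof of the theorem. -/

namespace TrigCurve

/-- A polynomial dividing its conjugate is real up to a constant of modulus one if the smallest
rectangle containing its support is symmetric. -/
lemma conjPoly_eq_smul {K L : ℕ} {p γ : TrigPoly} (hp : p ≠ 0)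
    (hsupp : p.coeff.support ⊆ freqRect K L) (hdeg : p.deg = (2 * K + 1, 2 * L + 1))
    (hγ : conjPoly p = γ * p) : ∃ C : ℂ, ‖C‖ = 1 ∧ conjPoly p = C • p := by
  have hne : conjPoly p ≠ 0 := by
    intro h0
    apply hp
    rw [← conjPoly_conjPoly p, h0]
    exact eval_injective (by ext r; simp)
  have hγ0 : γ ≠ 0 := by
    rintro rfl
    rw [zero_mul] at hγ
    exact hne hγ
  -- Conjugation reflects frequencies and the rectangle is symmetric, so `γ * p` fits in the
  -- smallest rectangle of `p` and `γ` is constant.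
  have hconst := support_quotient_subset hp hγ0 hsupp hdeg (by
    rw [mul_comm, ← hγ]
    intro k hk
    have := mem_freqRect.mp (hsupp ((mem_support_conjPoly p k).mp hk))
    rw [mem_freqRect]
    simp only [Prod.fst_neg, Prod.snd_neg] at this
    omega)
  have hC : conjPoly p = γ.coeff 0 • p := by
    rw [hγ, eq_smul_one_of_support hconst, smul_mul_assoc, one_mul]
    simp
  refine ⟨γ.coeff 0, ?_, hC⟩
  obtain ⟨r, hr⟩ : ∃ r, p.eval r ≠ 0 := by
    by_contra! h
    exact hp (eval_injective (by ext r; simp [h]))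
  have h1 := congrArg (fun q : TrigPoly => ‖q.eval r‖) hC
  simp only [eval_conjPoly, eval_smul, norm_mul, RCLike.norm_conj] at h1
  have h2 : ‖p.eval r‖ ≠ 0 := norm_ne_zero_iff.mpr hr
  exact mul_right_cancel₀ h2 (by rw [← h1, one_mul])

end TrigCurve

end

theorem theorem2 (n : ℕ) (a : Fin n → ℂ) (Ω : Fin n → Set (ℝ × ℝ))
    (μ : Fin n → TrigCurve.TrigPoly) (K L : ℕ)
    (ha : ∀ i, a i ≠ 0)
    (hΩ_open : ∀ i, IsOpen (Ω i))
    (hΩ_simply : ∀ i, IsSimplyConnected (Ω i))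
    (hΩ_sub : ∀ i, Ω i ⊆ TrigCurve.unitSquare)
    (hμ : ∀ i, TrigCurve.IsMinimalPoly (μ i) (frontier (Ω i)))
    (hdisj : Pairwise fun i j => Disjoint (frontier (Ω i)) (frontier (Ω j)))
    (hsupp : (∏ i, μ i).coeff.support ⊆ TrigCurve.freqRect K L)
    (hdeg : (∏ i, μ i).deg = (2 * K + 1, 2 * L + 1)) :
    (∏ i, μ i) ≠ 0 ∧
    TrigCurve.SolvesAnnihilation (TrigCurve.piecewiseConst a Ω)
      (TrigCurve.freqRect K L) (TrigCurve.freqRect (2 * K) (2 * L)) (∏ i, μ i).coeff ∧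
    (∀ d : TrigCurve.TrigPoly, d ≠ 0 → d.coeff.support ⊆ TrigCurve.freqRect K L →
      TrigCurve.SolvesAnnihilation (TrigCurve.piecewiseConst a Ω)
        (TrigCurve.freqRect K L) (TrigCurve.freqRect (2 * K) (2 * L)) d.coeff →
      (∃ c : ℂ, c ≠ 0 ∧ d = c • ∏ i, μ i) ∧
      TrigCurve.zeroSet d = ⋃ i, frontier (Ω i)) := by
  classical
  have hb (i : Fin n) : Bornology.IsBounded (Ω i) :=
    TrigCurve.isBounded_of_subset_unitSquare (hΩ_sub i)
  have hconn (i : Fin n) : IsConnected (Ω i) := (hΩ_simply i).isPathConnected.isConnected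
  have hμ0 (i : Fin n) : μ i ≠ 0 := (hμ i).ne_zero (hΩ_open i) (hΩ_sub i) (hconn i).nonempty
  have hprod0 : (∏ i, μ i) ≠ 0 := Finset.prod_ne_zero_iff.mpr fun i _ => hμ0 i
  have F (i : Fin n) : TrigCurve.RealForm (μ i) (Ω i) :=
    Classical.choice ((hμ i).nonempty_realForm (hΩ_open i) (hΩ_sub i) (hconn i))
  have hzero : TrigCurve.zeroSet (∏ i, μ i) = ⋃ i, frontier (Ω i) := by
    rw [TrigCurve.zeroSet_prod]
    exact Set.iUnion_congr fun i => (hμ i).zeroSet_eq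
  obtain ⟨C, hC, hconj⟩ := TrigCurve.conjPoly_eq_smul hprod0 hsupp hdeg (γ := ∏ i, (F i).γ) (by
    refine TrigCurve.eval_injective ?_
    ext r
    rw [TrigCurve.eval_conjPoly, TrigCurve.eval_mul, TrigCurve.eval_prod, TrigCurve.eval_prod,
      map_prod, ← Finset.prod_mul_distrib]
    refine Finset.prod_congr rfl fun i _ => ?_
    rw [← TrigCurve.eval_conjPoly, (F i).conjPoly_eq, TrigCurve.eval_mul])
  refine ⟨hprod0, fun l _ => ?_, fun d hd0 hd hsol => ?_⟩
  · have main (v : ℝ × ℝ) : ∑ k ∈ TrigCurve.freqRect K L, (∏ i, μ i).coeff k *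
        TrigCurve.fourierDeriv (TrigCurve.piecewiseConst a Ω) v
          (TrigCurve.latticeFreq (l - k)) = 0 := by
      rw [TrigCurve.sum_mul_fourierDeriv a hΩ_open hb v hsupp, neg_eq_zero]
      refine Finset.sum_eq_zero fun i _ => ?_
      rw [← Finset.mul_prod_erase _ _ (Finset.mem_univ i), mul_assoc,
        (F i).regionFlux_mul_eq_zero (hΩ_open i) (hb i), mul_zero]
    exact ⟨main _, main _⟩
  · have hvanish : ∀ i, ∀ r ∈ frontier (Ω i), d.eval r = 0 := by
      intro i
      set g := ∏ j ∈ Finset.univ.erase i, μ j with hg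
      have hgμ : g * μ i = ∏ j, μ j := Finset.prod_erase_mul _ _ (Finset.mem_univ i)
      have hg0 : g ≠ 0 := Finset.prod_ne_zero_iff.mpr fun j _ => hμ0 j
      refine (F i).eval_eq_zero_of_regionFlux (hμ i) (hμ0 i) (hΩ_open i) (hb i)
        (TrigCurve.isPreconnected_frontier (hΩ_open i) (hΩ_simply i) (hb i)) (g := g) ?_ hC
        (by rw [hgμ, hconj]) ?_
      · intro r hr
        rw [hg, TrigCurve.eval_prod, Finset.prod_ne_zero_iff]
        intro j hj h0
        have hsq : r ∈ TrigCurve.unitSquare := by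
          rw [← (hμ i).zeroSet_eq] at hr
          exact hr.1
        have hrj : r ∈ frontier (Ω j) := by
          rw [← (hμ j).zeroSet_eq]
          exact ⟨hsq, h0⟩
        exact Set.disjoint_left.mp (hdisj (Finset.ne_of_mem_erase hj)) hrj hr
      · have hflux (v : ℝ × ℝ) (hs : ∑ j, a j * TrigCurve.regionFlux (Ω j) (hb j) v
            (d * (TrigCurve.conjPoly d *
              (g * TrigCurve.multiplier (TrigCurve.derivSymbol v) (μ i)))) = 0) :
            TrigCurve.regionFlux (Ω i) (hb i) v (d * (TrigCurve.conjPoly d *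
              (g * TrigCurve.multiplier (TrigCurve.derivSymbol v) (μ i)))) = 0 := by
          rw [Finset.sum_eq_single i] at hs
          · exact (mul_eq_zero.mp hs).resolve_left (ha i)
          -- For `j ≠ i` the factor `μ j` of `g` makes the integrand a multiple of `μ j`, without
          -- flux through the frontier of `Ω j`.
          · intro j _ hji
            rw [hg, ← Finset.mul_prod_erase _ _ (Finset.mem_erase.mpr ⟨hji, Finset.mem_univ j⟩)]
            set e := ∏ k ∈ (Finset.univ.erase i).erase j, μ k
            set D := TrigCurve.multiplier (TrigCurve.derivSymbol v) (μ i)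
            rw [show d * (TrigCurve.conjPoly d * (μ j * e * D)) =
                μ j * (d * TrigCurve.conjPoly d * e * D) by ring,
              (F j).regionFlux_mul_eq_zero (hΩ_open j) (hb j), mul_zero]
          · intro h
            exact absurd (Finset.mem_univ i) h
        -- This is where the size `2Λ` of the equation set enters: one `Λ` for `conjPoly d`, one for
        -- `g ∂ᵥμᵢ`.
        have hsub (v : ℝ × ℝ) : (TrigCurve.conjPoly d *
            (g * TrigCurve.multiplier (TrigCurve.derivSymbol v) (μ i))).coeff.support ⊆
              TrigCurve.freqRect (2 * K) (2 * L) :=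
          TrigCurve.support_conjPoly_mul_subset hd
            (TrigCurve.support_mul_multiplier_subset hg0 (hμ0 i) (by rw [hgμ]; exact hsupp) _)
        rintro v (rfl | rfl)
        · exact hflux _ (hsol.sum_regionFlux_eq_zero hΩ_open hb hd (hsub _)).1
        · exact hflux _ (hsol.sum_regionFlux_eq_zero hΩ_open hb hd (hsub _)).2
    obtain ⟨γ, hγ⟩ := TrigCurve.prod_dvd_of_forall_eval_eq_zero Finset.univ
      (fun i _ => hμ i) (fun i _ => hμ0 i) hdisj fun i _ => hvanish i
    have hγ0 : γ ≠ 0 := by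
      rintro rfl
      exact hd0 (by rw [hγ, mul_zero])
    have hconst := TrigCurve.eq_smul_one_of_support
      (TrigCurve.support_quotient_subset hprod0 hγ0 hsupp hdeg (by rw [← hγ]; exact hd))
    have hdc : d = γ.coeff 0 • ∏ i, μ i := by
      rw [hγ]
      conv_lhs => rw [hconst]
      rw [mul_smul_comm, mul_one]
    have hc0 : γ.coeff 0 ≠ 0 := by
      intro h
      exact hd0 (by rw [hdc, h, zero_smul])
    refine ⟨⟨γ.coeff 0, hc0, hdc⟩, ?_⟩
    rw [hdc, TrigCurve.zeroSet_smul hc0, hzero]
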